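/- Let $(X,\mu)$ be a standard probability space, let $m>1$ and $k\ge 1$ be integers, let $\alpha:\{1,\dots,m\}\to\{1,\dots,k\}$ be a (not necessarily surjective) map, and let $T_1,\dots,T_m$ be ergodic measure preserving transformations of $(X,\mu)$. Let $1\le p<\infty$ and let $E=L^p(X,\mu)$ (complex valued functions). Write $T_jg:=g\circ T_j$ also for the operator induced by $T_j$ on $E$. For each $j$ put $$E_{j,r}:=\overline{\operatorname{lin}}\{f\in E:\ T_jf=\lambda f\ \text{for some}\ |\lambda|=1\},$$ $$E_{j,s}:=\Big\{f\in E:\ \lim_{N\to\infty}\frac1N\sum_{n=1}^N|\varphi(T_j^nf)|=0\ \text{for every}\ \varphi\in E'\Big\},$$ the reversible and the stable part of the Jacobs–Glicksberg–deLeeuw decomposition $E=E_{j,r}\oplus E_{j,s}$ corresponding to $T_j$. Let $A_1,\dots,A_{m-1}$ be bounded linear operators on $E$ with the following two properties. (A1) (Twisted compactness) For all $f\in E$, $1\le j\le m-1$ and $\varepsilon>0$ there is a decomposition $E=\mathcal U\oplus\mathcal R$ into closed subspaces with $\dim\mathcal U<\infty$ such that $P_{\mathcal R}A_jT_j^nf\in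 L^\infty(X,\mu)$ and $\|P_{\mathcal R}A_jT_j^nf\|_\infty\le\varepsilon$ for all $n\ge1$, where $P_{\mathcal R}$ is the projection onto $\mathcal R$ along $\mathcal U$. (A2) (Joint $L^\infty$-boundedness) There is a constant $C>0$ such that, for all $1\le j\le m-1$ and $n\ge1$, the operator $A_jT_j^n$ maps $L^\infty(X,\mu)\cap E$ into $L^\infty(X,\mu)$ with $\|A_jT_j^ng\|_\infty\le C\|g\|_\infty$. Then the following hold. (1) For each $f\in E_{1,s}$, $$\lim_{N\to\infty}\frac1{N^k}\sum_{1\le n_1,\dots,n_k\le N}\left|T_m^{n_{\alpha(m)}}A_{m-1}T_{m-1}^{n_{\alpha(m-1)}}\cdots A_2T_2^{n_{\alpha(2)}}A_1T_1^{n_{\alpha(1)}}f\right|=0\quad\text{pointwise a.e.}$$ (2) If $p=2$, then for each $f\in E_{1,r}$ the averages $$\frac1{N^k}\sum_{1\le n_1,\dots,n_k\le N}T_m^{n_{\alpha(m)}}A_{m-1}T_{m-1}^{n_{\alpha(m-1)}}\cdots A_2T_2^{n_{\alpha(2)}}A_1T_1^{n_{\alpha(1)}}f$$ converge pointwise a.e.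 as $N\to\infty$ (to a finite limit). -/

import Mathlib

open MeasureTheory Filter Topology
open scoped ENNReal

namespace Entangled

section Sequences

/-- The set `𝒩`: bounded complex sequences `(a n)`, `n ≥ 1`, with
`(1/N) ∑_{n=1}^N |a n| → 0`. (Boundedness is not affected by the value at `0`.) -/
def IsCesaroNull (a : ℕ → ℂ) : Prop :=
  (∃ C : ℝ, ∀ n, ‖a n‖ ≤ C) ∧
    Tendsto (fun N : ℕ => (1 / (N : ℝ)) * ∑ n ∈ Finset.Icc 1 N, ‖a n‖) atTop (𝓝 0)

theorem isCesaroNull_zero : IsCesaroNull (fun _ => 0) :=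
  ⟨⟨0, fun _ => by simp⟩, by simp⟩

theorem IsCesaroNull.add {a b : ℕ → ℂ} (ha : IsCesaroNull a) (hb : IsCesaroNull b) :
    IsCesaroNull (fun n => a n + b n) := by
  obtain ⟨⟨C, hC⟩, ha⟩ := ha
  obtain ⟨⟨D, hD⟩, hb⟩ := hb
  refine ⟨⟨C + D, fun n => (norm_add_le _ _).trans (add_le_add (hC n) (hD n))⟩, ?_⟩
  have hab := ha.add hb
  rw [add_zero] at hab
  refine squeeze_zero (fun N => by positivity) (fun N => ?_) hab
  rw [← mul_add, ← Finset.sum_add_distrib]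
  gcongr
  exact norm_add_le _ _

theorem IsCesaroNull.const_mul {a : ℕ → ℂ} (c : ℂ) (ha : IsCesaroNull a) :
    IsCesaroNull (fun n => c * a n) := by
  obtain ⟨⟨C, hC⟩, ha⟩ := ha
  refine ⟨⟨‖c‖ * C, fun n => ?_⟩, ?_⟩
  · rw [norm_mul]
    exact mul_le_mul_of_nonneg_left (hC n) (norm_nonneg c)
  · have h := ha.const_mul ‖c‖
    rw [mul_zero] at h
    refine h.congr (fun N => ?_)
    simp only [norm_mul, ← Finset.mul_sum]
    ring

end Sequences

section JacobsGlicksbergDeLeeuw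

variable {E : Type*} [NormedAddCommGroup E] [NormedSpace ℂ E]

/-- The reversible part `E_r`: the closed linear span of the eigenvectors of `S` with
unimodular eigenvalue. -/
noncomputable def reversiblePart (S : E →L[ℂ] E) : Submodule ℂ E :=
  (Submodule.span ℂ {f : E | ∃ c : ℂ, ‖c‖ = 1 ∧ S f = c • f}).topologicalClosure

/-- The (almost weakly) stable part `E_s`: all `f` with `(φ (S ^ n f))ₙ ∈ 𝒩` for every
continuous linear functional `φ`. -/
def stablePart (S : E →L[ℂ] E) : Submodule ℂ E where
  carrier := {f : E | ∀ φ : StrongDual ℂ E, IsCesaroNull (fun n => φ ((S ^ n) f))}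
  zero_mem' φ := by simpa using isCesaroNull_zero
  add_mem' {f g} hf hg φ := by simpa using (hf φ).add (hg φ)
  smul_mem' c f hf φ := by simpa using (hf φ).const_mul c

/-- For operators `S 0, …, S m` and `A 0, …, A (m - 1)`, the product
`S m ∘ A (m - 1) ∘ S (m - 1) ∘ ⋯ ∘ A 0 ∘ S 0`. -/
def alternatingProduct :
    (m : ℕ) → (Fin m → (E →L[ℂ] E)) → (Fin (m + 1) → (E →L[ℂ] E)) → (E →L[ℂ] E)
  | 0, _, S => S 0
  | m + 1, A, S =>
      (S (Fin.last (m + 1))).comp ((A (Fin.last m)).comp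
        (alternatingProduct m (fun j => A j.castSucc) (fun j => S j.castSucc)))

end JacobsGlicksbergDeLeeuw

section Lp

variable {X : Type*} [MeasurableSpace X] {μ : Measure X}

/-- The Koopman operator `g ↦ g ∘ T` on `L^p(X, μ)` of a measure preserving map `T`. -/
noncomputable def koopman (p : ℝ≥0∞) [Fact (1 ≤ p)] {T : X → X}
    (hT : MeasurePreserving T μ μ) : Lp ℂ p μ →L[ℂ] Lp ℂ p μ :=
  (Lp.compMeasurePreservingₗᵢ ℂ T hT).toContinuousLinearMap

variable {p : ℝ≥0∞} [Fact (1 ≤ p)]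

/-- Twisted compactness of the pair `(A, S)`: for all `f` and `ε > 0` the Banach space `L^p` is a
(topological) direct sum `U ⊕ R` with `U` finite dimensional, such that the projection onto `R`
along `U` maps every `A (S ^ n f)`, `n ≥ 1`, into the ball of radius `ε` of `L^∞`. -/
def TwistedCompact (A S : Lp ℂ p μ →L[ℂ] Lp ℂ p μ) : Prop :=
  ∀ (f : Lp ℂ p μ) (ε : ℝ), 0 < ε →
    ∃ (U R : Submodule ℂ (Lp ℂ p μ)) (h : IsCompl R U),
      FiniteDimensional ℂ U ∧ IsClosed (R : Set (Lp ℂ p μ)) ∧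
        ∀ n : ℕ, 1 ≤ n →
          eLpNorm (R.projection U h (A ((S ^ n) f))) ∞ μ ≤ ENNReal.ofReal ε

/-- `B` maps `L^∞ ∩ L^p` to `L^∞`, with operator norm at most `C` for the `L^∞`-norm. -/
def LinftyBoundedBy (C : ℝ) (B : Lp ℂ p μ →L[ℂ] Lp ℂ p μ) : Prop :=
  ∀ g : Lp ℂ p μ, MemLp g ∞ μ → eLpNorm (B g) ∞ μ ≤ ENNReal.ofReal C * eLpNorm g ∞ μ

/-- For `n ∈ ℕ^k` the entangled product
`T_{m+1}^{n_{α(m+1)}} A_m T_m^{n_{α(m)}} ⋯ A_1 T_1^{n_{α(1)}} f`, with indices shifted to start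
at `0`; here `S j` is the Koopman operator of the `j`-th transformation. -/
noncomputable def entangledProduct {m k : ℕ} (α : Fin (m + 1) → Fin k)
    (A : Fin m → (Lp ℂ p μ →L[ℂ] Lp ℂ p μ)) (S : Fin (m + 1) → (Lp ℂ p μ →L[ℂ] Lp ℂ p μ))
    (f : Lp ℂ p μ) (n : Fin k → ℕ) : Lp ℂ p μ :=
  alternatingProduct m A (fun j => S j ^ n (α j)) f

end Lp

/-- The multi-Cesàro mean `N^{-k} ∑_{1 ≤ n_1, …, n_k ≤ N} F (n_1, …, n_k)`. -/
noncomputable def multiCesaro {V : Type*} [AddCommGroup V] [Module ℝ V] {k : ℕ}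
    (F : (Fin k → ℕ) → V) (N : ℕ) : V :=
  (1 / (N : ℝ) ^ k) • ∑ n ∈ Fintype.piFinset (fun _ : Fin k => Finset.Icc 1 N), F n

end Entangled

/-!
The operators between consecutive transformations are removed one at a time. By twisted compactness,
an orbit `A (S ^ n f)` is, up to an error that is uniformly small in `L^∞`, a combination
`∑ᵢ φᵢ (S ^ n f) • gᵢ` of finitely many fixed vectors, whose coefficients are correlation sequences
of `f`; the joint `L^∞`-bound keeps the error small under the remaining operators. Iterating
(`exists_expandable_entangledProduct`) replaces the entangled product by a finite sum of terms
`(∏ₗ dₗ (n l)) • gᵢ (T^(n l₀) x)`, where `T` is the last transformation and each `dₗ` is a product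
of correlation sequences. The multiple Cesàro mean of such a term factors into one-variable
weighted ergodic averages (`multiCesaro_prod`).

If `f` is stable, one of the weights is Cesàro null. Its factor tends to zero
(`ae_tendsto_cesaro_null_mul`) and the other factors stay bounded. For ergodic `T` both follow
from the bound `limsup_N N⁻¹ ∑_{n ≤ N} |g (T^n x)| ≤ ∫ |g|` (`ae_eventually_cesaro_le`), the only
part of the pointwise ergodic theorem that is needed.

If `p = 2`, all correlation sequences of a Koopman operator are bounded Besicovitch almost periodic
sequences (`isBesicovitch_koopman`), a class closed under products, and the weighted averages with
such weights converge almost everywhere (`IsBesicovitch.weightedConverges`). The latter reduces to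
the weights `c ^ n` with `|c| = 1`, where the mean ergodic theorem for `c • koopman` writes an
`L²` function as a limit of sums of a fixed vector and a coboundary; the maximal bound above passes
to the limit. For the former, a vector orthogonal to all unimodular eigenvectors has null
correlations: the averages of the rank one operators `|S^n f⟩⟨S^n f|` converge in Hilbert–Schmidt
norm, by the mean ergodic theorem on `L²(μ × μ)`, to a compact symmetric operator commuting with
`S`, whose eigenspaces would contain eigenvectors of `S` if it were nonzero.
-/

open MeasureTheory Filter Topology
open scoped ENNReal

namespace Entangled

/-! ### Cesàro means along ergodic orbits -/

section Birkhoff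

variable {X : Type*} {T : X → X} {h : X → ℝ}

/-- The running maximum `x ↦ max_{1 ≤ k ≤ N + 1} ∑_{i < k} h (T^i x)` of the Birkhoff sums,
defined through its recursion. -/
def birkhoffMax (T : X → X) (h : X → ℝ) : ℕ → X → ℝ
  | 0, x => h x
  | N + 1, x => h x + max 0 (birkhoffMax T h N (T x))

theorem monotone_birkhoffMax (x : X) : Monotone fun N => birkhoffMax T h N x := by
  refine monotone_nat_of_le_succ fun N => ?_
  induction N generalizing x with
  | zero => simp [birkhoffMax]
  | succ N ih =>
    simp only [birkhoffMax] at ih ⊢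
    gcongr
    exact ih (T x)

theorem birkhoffSum_succ_le_birkhoffMax (N : ℕ) (x : X) :
    birkhoffSum T h (N + 1) x ≤ birkhoffMax T h N x := by
  induction N generalizing x with
  | zero => simp [birkhoffMax]
  | succ N ih =>
    rw [birkhoffSum_succ']
    simp only [birkhoffMax]
    gcongr
    exact (ih (T x)).trans (le_max_right _ _)

theorem bddAbove_birkhoffMax_comp_iff (x : X) :
    BddAbove (Set.range fun N => birkhoffMax T h N (T x)) ↔
      BddAbove (Set.range fun N => birkhoffMax T h N x) := by
  constructor
  · rintro ⟨B, hB⟩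
    refine ⟨h x + max 0 B, ?_⟩
    rintro _ ⟨N, rfl⟩
    refine (monotone_birkhoffMax x N.le_succ).trans ?_
    simp only [birkhoffMax]
    gcongr
    exact hB ⟨N, rfl⟩
  · rintro ⟨B, hB⟩
    refine ⟨B - h x, ?_⟩
    rintro _ ⟨N, rfl⟩
    have h1 : birkhoffMax T h (N + 1) x ≤ B := hB ⟨N + 1, rfl⟩
    simp only [birkhoffMax] at h1
    have h2 := le_max_right 0 (birkhoffMax T h N (T x))
    linarith

/-- The Cesàro mean `N⁻¹ ∑_{n=1}^N u n`. -/
noncomputable def cesaro {V : Type*} [AddCommGroup V] [Module ℝ V] (u : ℕ → V) (N : ℕ) : V :=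
  (N : ℝ)⁻¹ • ∑ n ∈ Finset.Icc 1 N, u n

theorem birkhoffSum_comp_eq_sum_Icc (N : ℕ) (x : X) :
    birkhoffSum T h N (T x) = ∑ n ∈ Finset.Icc 1 N, h (T^[n] x) := by
  induction N with
  | zero => simp
  | succ N ih =>
    rw [birkhoffSum_succ, ih, Finset.sum_Icc_succ_top (by omega), Function.iterate_succ_apply]

variable [MeasurableSpace X] {μ : Measure X}

theorem measurable_birkhoffMax (hT : Measurable T) (hh : Measurable h) (N : ℕ) :
    Measurable (birkhoffMax T h N) := by
  induction N with
  | zero => exact hh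
  | succ N ih => exact hh.add (measurable_const.max (ih.comp hT))

theorem integrable_birkhoffMax (hT : MeasurePreserving T μ μ) (hh : Integrable h μ) (N : ℕ) :
    Integrable (birkhoffMax T h N) μ := by
  induction N with
  | zero => exact hh
  | succ N ih =>
    exact hh.add ((integrable_zero _ _ _).sup (hT.integrable_comp_of_integrable ih))

/-- The form of the maximal ergodic theorem used here. If the set where the Birkhoff sums are
unbounded above had full measure, then
`0 ≤ ∫ (birkhoffMax (N + 1) - birkhoffMax N) = ∫ (h - min 0 (birkhoffMax N ∘ T)) → ∫ h`. -/
theorem ae_bddAbove_birkhoffMax (hT : Ergodic T μ) (hm : Measurable h) (hh : Integrable h μ)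
    (hneg : ∫ x, h x ∂μ < 0) :
    ∀ᵐ x ∂μ, BddAbove (Set.range fun N => birkhoffMax T h N x) := by
  have hmeas : MeasurableSet {x | BddAbove (Set.range fun N => birkhoffMax T h N x)} :=
    measurableSet_bddAbove_range fun N => measurable_birkhoffMax hT.measurable hm N
  have hinv : T ⁻¹' {x | BddAbove (Set.range fun N => birkhoffMax T h N x)} =
      {x | BddAbove (Set.range fun N => birkhoffMax T h N x)} := by
    ext x
    exact bddAbove_birkhoffMax_comp_iff x
  rcases hT.toPreErgodic.ae_mem_or_ae_notMem hmeas hinv with h1 | h1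
  · exact h1
  exfalso
  have hMP := hT.toMeasurePreserving
  have hlim : Tendsto (fun N => ∫ x, (birkhoffMax T h (N + 1) x - birkhoffMax T h N (T x)) ∂μ)
      atTop (𝓝 (∫ x, h x ∂μ)) := by
    refine tendsto_integral_of_dominated_convergence (fun x => |h x| + |h (T x)|)
      (fun N => ?_) ?_ (fun N => ?_) ?_
    · exact ((integrable_birkhoffMax hMP hh _).sub
        (hMP.integrable_comp_of_integrable (integrable_birkhoffMax hMP hh _))).aestronglyMeasurable
    · exact hh.abs.add (hMP.integrable_comp_of_integrable hh.abs)
    · refine ae_of_all _ fun x => ?_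
      have h0 : h (T x) ≤ birkhoffMax T h N (T x) := monotone_birkhoffMax (T x) N.zero_le
      simp only [birkhoffMax, Real.norm_eq_abs]
      rcases le_total 0 (birkhoffMax T h N (T x)) with hp | hp
      · rw [max_eq_right hp, add_sub_cancel_right]
        exact le_add_of_nonneg_right (abs_nonneg _)
      · rw [max_eq_left hp, add_zero]
        refine (abs_sub _ _).trans ?_
        have h2 : |birkhoffMax T h N (T x)| ≤ |h (T x)| := by
          rw [abs_of_nonpos hp, abs_of_nonpos (h0.trans hp)]
          linarith
        linarith
    · filter_upwards [h1] with x hx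
      have hx' : ¬ BddAbove (Set.range fun N => birkhoffMax T h N (T x)) :=
        fun hb => hx ((bddAbove_birkhoffMax_comp_iff x).1 hb)
      obtain ⟨_, ⟨N, rfl⟩, hN⟩ := not_bddAbove_iff.1 hx' 0
      refine tendsto_const_nhds.congr' ?_
      filter_upwards [eventually_ge_atTop N] with M hM
      have h2 : 0 ≤ birkhoffMax T h M (T x) :=
        hN.le.trans (monotone_birkhoffMax (T x) hM)
      simp [birkhoffMax, max_eq_right h2]
  refine absurd (ge_of_tendsto' hlim fun N => ?_) (not_le.2 hneg)
  have h2 : Integrable (fun x => birkhoffMax T h N (T x)) μ :=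
    hMP.integrable_comp_of_integrable (integrable_birkhoffMax hMP hh N)
  have h3 : ∫ x, birkhoffMax T h N (T x) ∂μ = ∫ x, birkhoffMax T h N x ∂μ := by
    rw [← integral_map hMP.aemeasurable
      (by rw [hMP.map_eq]; exact (integrable_birkhoffMax hMP hh N).aestronglyMeasurable),
      hMP.map_eq]
  rw [integral_sub (integrable_birkhoffMax hMP hh _) h2, h3, sub_nonneg]
  exact integral_mono (integrable_birkhoffMax hMP hh _) (integrable_birkhoffMax hMP hh _)
    fun x => monotone_birkhoffMax x N.le_succ

variable [IsProbabilityMeasure μ]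

theorem ae_eventually_cesaro_le (hT : Ergodic T μ) (hm : Measurable h) (hh : Integrable h μ)
    {c : ℝ} (hc : ∫ x, h x ∂μ < c) :
    ∀ᵐ x ∂μ, ∀ᶠ N in atTop, cesaro (fun n => h (T^[n] x)) N ≤ c := by
  obtain ⟨b, hb1, hb2⟩ := exists_between hc
  have h1 := ae_bddAbove_birkhoffMax (h := fun x => h x - b) hT (hm.sub_const b)
    (hh.sub (integrable_const b)) (by
      rw [integral_sub hh (integrable_const b)]; simpa using hb1)
  filter_upwards [hT.toMeasurePreserving.quasiMeasurePreserving.ae h1] with x hx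
  obtain ⟨B, hB⟩ := hx
  have h2 : Tendsto (fun N : ℕ => b + B / N) atTop (𝓝 (b + 0)) :=
    tendsto_const_nhds.add (tendsto_const_div_atTop_nhds_zero_nat B)
  rw [add_zero] at h2
  filter_upwards [h2.eventually (eventually_le_nhds hb2), eventually_gt_atTop 0] with N hN hN0
  refine le_trans ?_ hN
  have h3 : birkhoffSum T (fun x => h x - b) N (T x) ≤ B := by
    obtain ⟨M, rfl⟩ := Nat.exists_eq_succ_of_ne_zero hN0.ne'
    exact (birkhoffSum_succ_le_birkhoffMax M (T x)).trans (hB ⟨M, rfl⟩)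
  rw [birkhoffSum_comp_eq_sum_Icc, Finset.sum_sub_distrib] at h3
  simp only [Finset.sum_const, Nat.card_Icc, add_tsub_cancel_right, nsmul_eq_mul] at h3
  have hN' : (0 : ℝ) < N := by exact_mod_cast hN0
  rw [cesaro, smul_eq_mul, inv_mul_le_iff₀ hN', mul_add, mul_div_cancel₀ _ hN'.ne']
  linarith

end Birkhoff

/-! ### Besicovitch almost periodic sequences -/

section CesaroLemmas

theorem cesaro_mono {u v : ℕ → ℝ} (huv : ∀ n, 1 ≤ n → u n ≤ v n) (N : ℕ) :
    cesaro u N ≤ cesaro v N := by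
  simp only [cesaro, smul_eq_mul]
  gcongr with n hn
  exact huv n (Finset.mem_Icc.1 hn).1

theorem cesaro_nonneg {u : ℕ → ℝ} (hu : ∀ n, 0 ≤ u n) (N : ℕ) : 0 ≤ cesaro u N := by
  simp only [cesaro, smul_eq_mul]
  exact mul_nonneg (by positivity) (Finset.sum_nonneg fun n _ => hu n)

theorem cesaro_const_le {c : ℝ} (hc : 0 ≤ c) (N : ℕ) : cesaro (fun _ => c) N ≤ c := by
  rcases Nat.eq_zero_or_pos N with rfl | hN
  · simpa [cesaro] using hc
  · have hN' : (N : ℝ) ≠ 0 := by exact_mod_cast hN.ne'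
    simp [cesaro, hN']

theorem cesaro_le_const {u : ℕ → ℝ} {c : ℝ} (hc : 0 ≤ c) (hu : ∀ n, 1 ≤ n → u n ≤ c) (N : ℕ) :
    cesaro u N ≤ c :=
  (cesaro_mono hu N).trans (cesaro_const_le hc N)

/-- A sequence in a complete space converges if it is eventually within any given distance of
some convergent sequence. -/
theorem exists_tendsto_of_forall_approx {V : Type*} [NormedAddCommGroup V] [CompleteSpace V] {u : ℕ → V}
    (h : ∀ ε : ℝ, 0 < ε → ∃ v : ℕ → V, (∃ c, Tendsto v atTop (𝓝 c)) ∧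
      ∀ᶠ N in atTop, ‖u N - v N‖ ≤ ε) :
    ∃ c, Tendsto u atTop (𝓝 c) := by
  refine cauchySeq_tendsto_of_complete (Metric.cauchySeq_iff'.2 fun ε hε => ?_)
  obtain ⟨v, ⟨c, hc⟩, hv⟩ := h (ε / 5) (by positivity)
  have h1 := hc.eventually (Metric.ball_mem_nhds c (by positivity : 0 < ε / 5))
  obtain ⟨M, hM⟩ := eventually_atTop.1 (hv.and h1)
  refine ⟨M, fun n hn => ?_⟩
  have key : ∀ n, M ≤ n → dist (u n) c < 2 * (ε / 5) := fun n hn => by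
    obtain ⟨h2, h3⟩ := hM n hn
    rw [← dist_eq_norm] at h2
    have h4 := dist_triangle (u n) (v n) c
    have h3 : dist (v n) c < ε / 5 := h3
    linarith
  have h5 := dist_triangle_right (u n) (u M) c
  have h6 := key n hn
  have h7 := key M le_rfl
  linarith

variable {V : Type*} [NormedAddCommGroup V] [NormedSpace ℝ V]

theorem cesaro_add (u v : ℕ → V) (N : ℕ) :
    cesaro (fun n => u n + v n) N = cesaro u N + cesaro v N := by
  simp [cesaro, Finset.sum_add_distrib]

theorem cesaro_sub (u v : ℕ → V) (N : ℕ) :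
    cesaro (fun n => u n - v n) N = cesaro u N - cesaro v N := by
  simp [cesaro, Finset.sum_sub_distrib, smul_sub]

theorem cesaro_const_mul (c : ℝ) (u : ℕ → ℝ) (N : ℕ) :
    cesaro (fun n => c * u n) N = c * cesaro u N := by
  simp only [cesaro, smul_eq_mul, ← Finset.mul_sum]
  ring

theorem norm_cesaro_le (u : ℕ → V) (N : ℕ) : ‖cesaro u N‖ ≤ cesaro (fun n => ‖u n‖) N := by
  rw [cesaro, cesaro, norm_smul, smul_eq_mul, Real.norm_of_nonneg (by positivity)]
  gcongr
  exact norm_sum_le _ _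

theorem IsCesaroNull.tendsto_cesaro {a : ℕ → ℂ} (ha : IsCesaroNull a) :
    Tendsto (cesaro fun n => ‖a n‖) atTop (𝓝 0) := by
  refine ha.2.congr fun N => ?_
  rw [cesaro, one_div, smul_eq_mul]

end CesaroLemmas

section Besicovitch

/-- The space of trigonometric polynomials `n ↦ ∑ᵢ cᵢ λᵢ ^ n` with `|λᵢ| = 1`. -/
def trigPoly : Submodule ℂ (ℕ → ℂ) :=
  Submodule.span ℂ {u | ∃ c : ℂ, ‖c‖ = 1 ∧ u = fun n => c ^ n}

theorem mul_mem_trigPoly {q s : ℕ → ℂ} (hq : q ∈ trigPoly) (hs : s ∈ trigPoly) :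
    q * s ∈ trigPoly := by
  have h := Submodule.mul_mem_mul hq hs
  rw [trigPoly, Submodule.span_mul_span] at h
  refine Submodule.span_mono ?_ h
  rintro _ ⟨_, ⟨c, hc, rfl⟩, _, ⟨d, hd, rfl⟩, rfl⟩
  exact ⟨c * d, by simp [hc, hd], by ext n; simp [mul_pow]⟩

theorem exists_bound_of_mem_trigPoly {q : ℕ → ℂ} (hq : q ∈ trigPoly) :
    ∃ C : ℝ, ∀ n, ‖q n‖ ≤ C := by
  induction hq using Submodule.span_induction with
  | mem u hu =>
    obtain ⟨c, hc, rfl⟩ := hu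
    exact ⟨1, fun n => by simp [hc]⟩
  | zero => exact ⟨0, fun n => by simp⟩
  | add u v _ _ hu hv =>
    obtain ⟨C, hC⟩ := hu
    obtain ⟨D, hD⟩ := hv
    exact ⟨C + D, fun n => (norm_add_le _ _).trans (add_le_add (hC n) (hD n))⟩
  | smul a u _ hu =>
    obtain ⟨C, hC⟩ := hu
    exact ⟨‖a‖ * C, fun n => by
      rw [Pi.smul_apply, norm_smul]
      exact mul_le_mul_of_nonneg_left (hC n) (norm_nonneg a)⟩

/-- Bounded Besicovitch almost periodic sequences: bounded sequences that trigonometric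
polynomials approximate in the seminorm `limsup_N N⁻¹ ∑_{n=1}^N |c n|`. Cesàro null sequences
belong to this class. -/
def IsBesicovitch (c : ℕ → ℂ) : Prop :=
  (∃ C : ℝ, ∀ n, ‖c n‖ ≤ C) ∧
    ∀ ε : ℝ, 0 < ε → ∃ q ∈ trigPoly, ∀ᶠ N in atTop, cesaro (fun n => ‖c n - q n‖) N ≤ ε

theorem IsCesaroNull.isBesicovitch {a : ℕ → ℂ} (ha : IsCesaroNull a) : IsBesicovitch a := by
  refine ⟨ha.1, fun ε hε => ⟨0, zero_mem _, ?_⟩⟩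
  filter_upwards [ha.tendsto_cesaro.eventually (eventually_le_nhds hε)] with N hN
  simpa using hN

theorem isBesicovitch_of_mem_trigPoly {q : ℕ → ℂ} (hq : q ∈ trigPoly) : IsBesicovitch q :=
  ⟨exists_bound_of_mem_trigPoly hq, fun ε hε => ⟨q, hq, by simp [cesaro, hε.le]⟩⟩

theorem isBesicovitch_one : IsBesicovitch 1 :=
  isBesicovitch_of_mem_trigPoly (Submodule.subset_span ⟨1, by simp, by ext n; simp⟩)

theorem IsBesicovitch.add {c d : ℕ → ℂ} (hc : IsBesicovitch c) (hd : IsBesicovitch d) :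
    IsBesicovitch (c + d) := by
  obtain ⟨⟨C, hC⟩, hc⟩ := hc
  obtain ⟨⟨D, hD⟩, hd⟩ := hd
  refine ⟨⟨C + D, fun n => (norm_add_le _ _).trans (add_le_add (hC n) (hD n))⟩, fun ε hε => ?_⟩
  obtain ⟨q, hq, hcq⟩ := hc (ε / 2) (by positivity)
  obtain ⟨s, hs, hds⟩ := hd (ε / 2) (by positivity)
  refine ⟨q + s, add_mem hq hs, ?_⟩
  filter_upwards [hcq, hds] with N h1 h2
  have h3 : cesaro (fun n => ‖(c + d) n - (q + s) n‖) N ≤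
      cesaro (fun n => ‖c n - q n‖ + ‖d n - s n‖) N :=
    cesaro_mono (fun n _ => by
      simpa [add_sub_add_comm] using norm_add_le (c n - q n) (d n - s n)) N
  rw [cesaro_add] at h3
  linarith

theorem IsBesicovitch.mul {c d : ℕ → ℂ} (hc : IsBesicovitch c) (hd : IsBesicovitch d) :
    IsBesicovitch (c * d) := by
  obtain ⟨⟨C, hC⟩, hc⟩ := hc
  obtain ⟨⟨D, hD⟩, hd⟩ := hd
  have hC0 : 0 ≤ C := (norm_nonneg _).trans (hC 0)
  refine ⟨⟨C * D, fun n => ?_⟩, fun ε hε => ?_⟩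
  · rw [Pi.mul_apply, norm_mul]
    exact mul_le_mul (hC n) (hD n) (norm_nonneg _) hC0
  obtain ⟨s, hs, hds⟩ := hd (ε / 2 / (C + 1)) (by positivity)
  obtain ⟨S, hS⟩ := exists_bound_of_mem_trigPoly hs
  have hS0 : 0 ≤ S := (norm_nonneg _).trans (hS 0)
  obtain ⟨q, hq, hcq⟩ := hc (ε / 2 / (S + 1)) (by positivity)
  refine ⟨q * s, mul_mem_trigPoly hq hs, ?_⟩
  filter_upwards [hcq, hds] with N h1 h2
  have h3 : cesaro (fun n => ‖(c * d) n - (q * s) n‖) N ≤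
      cesaro (fun n => (C + 1) * ‖d n - s n‖ + (S + 1) * ‖c n - q n‖) N := by
    refine cesaro_mono (fun n _ => ?_) N
    have h4 : (c * d) n - (q * s) n = c n * (d n - s n) + s n * (c n - q n) := by
      simp only [Pi.mul_apply]; ring
    rw [h4]
    refine (norm_add_le _ _).trans ?_
    rw [norm_mul, norm_mul]
    gcongr
    · linarith [hC n]
    · linarith [hS n]
  rw [cesaro_add, cesaro_const_mul, cesaro_const_mul] at h3
  rw [le_div_iff₀ (by positivity)] at h1 h2
  linarith

/-- Uniform limits of trigonometric polynomials are Besicovitch almost periodic. -/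
theorem isBesicovitch_of_forall_approx {c : ℕ → ℂ}
    (h : ∀ ε : ℝ, 0 < ε → ∃ q ∈ trigPoly, ∀ n, ‖c n - q n‖ ≤ ε) : IsBesicovitch c := by
  refine ⟨?_, fun ε hε => ?_⟩
  · obtain ⟨q, hq, hcq⟩ := h 1 one_pos
    obtain ⟨C, hC⟩ := exists_bound_of_mem_trigPoly hq
    refine ⟨1 + C, fun n => ?_⟩
    have := norm_add_le (c n - q n) (q n)
    rw [sub_add_cancel] at this
    exact this.trans (add_le_add (hcq n) (hC n))
  · obtain ⟨q, hq, hcq⟩ := h ε hε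
    exact ⟨q, hq, Eventually.of_forall (cesaro_le_const hε.le fun n _ => hcq n)⟩

end Besicovitch

section Reversible

variable {E : Type*} [NormedAddCommGroup E] [NormedSpace ℂ E]

theorem norm_pow_apply_le {S : E →L[ℂ] E} (hS : ∀ f, ‖S f‖ ≤ ‖f‖) (n : ℕ) (f : E) :
    ‖(S ^ n) f‖ ≤ ‖f‖ := by
  induction n with
  | zero => simp
  | succ n ih =>
    rw [pow_succ', mul_apply_eq_comp]
    exact (hS _).trans ih

theorem pow_apply_of_eigenvector {S : E →L[ℂ] E} {f : E} {c : ℂ} (hf : S f = c • f) (n : ℕ) :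
    (S ^ n) f = c ^ n • f := by
  induction n with
  | zero => simp
  | succ n ih =>
    rw [pow_succ', mul_apply_eq_comp, ih, map_smul, hf, smul_smul, pow_succ]

theorem isBesicovitch_of_mem_reversiblePart {S : E →L[ℂ] E} (hS : ∀ f, ‖S f‖ ≤ ‖f‖) {f : E}
    (hf : f ∈ reversiblePart S) (φ : StrongDual ℂ E) :
    IsBesicovitch fun n => φ ((S ^ n) f) := by
  refine isBesicovitch_of_forall_approx fun ε hε => ?_
  obtain ⟨g, hg, hfg⟩ := Metric.mem_closure_iff.1 hf (ε / (‖φ‖ + 1)) (by positivity)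
  refine ⟨fun n => φ ((S ^ n) g), ?_, fun n => ?_⟩
  · clear hfg
    induction hg using Submodule.span_induction with
    | mem u hu =>
      obtain ⟨c, hc, hu⟩ := hu
      have h1 : (fun n => φ ((S ^ n) u)) = φ u • fun n => c ^ n := by
        ext n
        simp [pow_apply_of_eigenvector hu, mul_comm]
      rw [h1]
      exact Submodule.smul_mem _ _ (Submodule.subset_span ⟨c, hc, rfl⟩)
    | zero =>
      simp only [map_zero]
      exact zero_mem trigPoly
    | add u v _ _ hu hv =>
      simp only [map_add]
      exact add_mem hu hv
    | smul a u _ hu =>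
      simp only [map_smul]
      exact trigPoly.smul_mem a hu
  · rw [← map_sub, ← map_sub]
    refine (φ.le_opNorm _).trans ?_
    rw [dist_eq_norm, lt_div_iff₀ (by positivity)] at hfg
    have h1 := norm_pow_apply_le hS n (f - g)
    nlinarith [norm_nonneg φ, norm_nonneg (f - g)]

end Reversible

/-! ### Weighted pointwise ergodic theorems -/

section Koopman

variable {X : Type*} [MeasurableSpace X] {μ : Measure X} {T : X → X}

theorem ae_forall_iterate (hT : MeasurePreserving T μ μ) {P : X → Prop} (hP : ∀ᵐ x ∂μ, P x) :
    ∀ᵐ x ∂μ, ∀ n : ℕ, P (T^[n] x) :=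
  ae_all_iff.2 fun n => (hT.iterate n).quasiMeasurePreserving.ae hP

variable {p : ℝ≥0∞} [Fact (1 ≤ p)]

theorem koopman_coeFn (hT : MeasurePreserving T μ μ) (f : Lp ℂ p μ) :
    koopman p hT f =ᵐ[μ] fun x => f (T x) :=
  Lp.coeFn_compMeasurePreserving f hT

theorem norm_koopman (hT : MeasurePreserving T μ μ) (f : Lp ℂ p μ) : ‖koopman p hT f‖ = ‖f‖ :=
  Lp.norm_compMeasurePreserving f hT

theorem koopman_pow_coeFn (hT : MeasurePreserving T μ μ) (f : Lp ℂ p μ) (n : ℕ) :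
    (koopman p hT ^ n) f =ᵐ[μ] fun x => f (T^[n] x) := by
  induction n with
  | zero => simp
  | succ n ih =>
    rw [pow_succ', mul_apply_eq_comp]
    filter_upwards [koopman_coeFn hT ((koopman p hT ^ n) f),
      hT.quasiMeasurePreserving.ae ih] with x h1 h2
    rw [h1, h2, Function.iterate_succ_apply]

end Koopman

section Weighted

variable {X : Type*} [MeasurableSpace X] {μ : Measure X} {T : X → X}

/-- Almost everywhere convergence of the weighted ergodic averages
`N⁻¹ ∑_{n=1}^N d n * g (T^n x)`. -/
def WeightedConverges (T : X → X) (μ : Measure X) (d : ℕ → ℂ) (g : X → ℂ) : Prop :=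
  ∀ᵐ x ∂μ, ∃ c, Tendsto (cesaro fun n => d n * g (T^[n] x)) atTop (𝓝 c)

theorem WeightedConverges.congr (hT : MeasurePreserving T μ μ) {d : ℕ → ℂ} {g g' : X → ℂ}
    (h : WeightedConverges T μ d g) (hg : g =ᵐ[μ] g') : WeightedConverges T μ d g' := by
  filter_upwards [h, ae_forall_iterate hT hg] with x h1 h2
  simpa only [h2] using h1

theorem WeightedConverges.add {d : ℕ → ℂ} {g g' : X → ℂ}
    (h : WeightedConverges T μ d g) (h' : WeightedConverges T μ d g') :
    WeightedConverges T μ d fun x => g x + g' x := by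
  filter_upwards [h, h'] with x ⟨a, ha⟩ ⟨b, hb⟩
  refine ⟨a + b, (ha.add hb).congr fun N => ?_⟩
  rw [← cesaro_add]
  simp only [mul_add]

theorem exists_bounded_approx {g : X → ℂ} (hm : Measurable g) (hg : Integrable g μ) {ε : ℝ}
    (hε : 0 < ε) :
    ∃ (M : ℝ) (g' : X → ℂ), 0 ≤ M ∧ Measurable g' ∧ Integrable g' μ ∧ (∀ x, ‖g' x‖ ≤ M) ∧
      ∫ x, ‖g x - g' x‖ ∂μ < ε := by
  have hs : ∀ M : ℕ, MeasurableSet {x | ‖g x‖ ≤ M} := fun M =>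
    measurableSet_le hm.norm measurable_const
  have hlim : Tendsto (fun M : ℕ => ∫ x, ‖g x - {x | ‖g x‖ ≤ M}.indicator g x‖ ∂μ) atTop
      (𝓝 (∫ _, (0 : ℝ) ∂μ)) := by
    refine tendsto_integral_of_dominated_convergence (fun x => ‖g x‖) (fun M => ?_) hg.norm
      (fun M => ae_of_all _ fun x => ?_) (ae_of_all _ fun x => ?_)
    · exact (hm.sub (hm.indicator (hs M))).norm.aestronglyMeasurable
    · by_cases hx : x ∈ {x | ‖g x‖ ≤ M}
      · simp [Set.indicator_of_mem hx]
      · simp [Set.indicator_of_notMem hx]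
    · obtain ⟨M, hM⟩ := exists_nat_ge ‖g x‖
      refine tendsto_const_nhds.congr' ?_
      filter_upwards [eventually_ge_atTop M] with K hK
      have hx : x ∈ {x | ‖g x‖ ≤ K} := hM.trans (by exact_mod_cast hK)
      simp [Set.indicator_of_mem hx]
  rw [integral_zero] at hlim
  obtain ⟨M, hM⟩ := (hlim.eventually (gt_mem_nhds hε)).exists
  refine ⟨M, {x | ‖g x‖ ≤ M}.indicator g, M.cast_nonneg, hm.indicator (hs M),
    hg.indicator (hs M), fun x => ?_, hM⟩
  by_cases hx : x ∈ {x | ‖g x‖ ≤ M}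
  · rw [Set.indicator_of_mem hx]
    exact hx
  · simp [Set.indicator_of_notMem hx]

theorem measurable_Lp {p : ℝ≥0∞} (f : Lp ℂ p μ) : Measurable f :=
  (Lp.stronglyMeasurable f).measurable

theorem weightedConverges_of_fixed (hT : MeasurePreserving T μ μ) {c : ℂ} {f : Lp ℂ 2 μ}
    (hf : c • koopman 2 hT f = f) : WeightedConverges T μ (fun n => c ^ n) f := by
  have h1 : ∀ᵐ x ∂μ, c * f (T x) = f x := by
    have h2 := Lp.coeFn_smul c (koopman 2 hT f)
    rw [hf] at h2
    filter_upwards [h2, koopman_coeFn hT f] with x h3 h4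
    rw [h3, Pi.smul_apply, h4, smul_eq_mul]
  filter_upwards [ae_forall_iterate hT h1] with x hx
  have h2 : ∀ n, c ^ n * f (T^[n] x) = f x := fun n => by
    induction n with
    | zero => simp
    | succ n ih =>
      rw [pow_succ, mul_assoc, Function.iterate_succ_apply', hx n, ih]
  refine ⟨f x, tendsto_const_nhds.congr' ?_⟩
  filter_upwards [eventually_gt_atTop 0] with N hN
  have hN' : (N : ℂ) ≠ 0 := by exact_mod_cast hN.ne'
  simp [cesaro, h2, hN']

variable [IsProbabilityMeasure μ]

/-- Splitting `g` into a bounded part and a part small in `L¹` reduces this to the boundedness of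
the ergodic averages of the second part. -/
theorem ae_tendsto_cesaro_null_mul (hT : Ergodic T μ) {d : ℕ → ℂ} (hd : IsCesaroNull d)
    {g : X → ℂ} (hm : Measurable g) (hg : Integrable g μ) :
    ∀ᵐ x ∂μ, Tendsto (cesaro fun n => ‖d n‖ * ‖g (T^[n] x)‖) atTop (𝓝 0) := by
  obtain ⟨C, hC⟩ := hd.1
  have hC0 : 0 ≤ C := (norm_nonneg _).trans (hC 0)
  choose M g' hM0 hm' hg' hM happ using fun j : ℕ =>
    exists_bounded_approx hm hg (by positivity : 0 < 1 / ((j : ℝ) + 1))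
  have h1 := ae_all_iff.2 fun j => ae_eventually_cesaro_le hT (hm.sub (hm' j)).norm
    (hg.sub (hg' j)).norm (happ j)
  filter_upwards [h1] with x hx
  refine tendsto_order.2 ⟨fun a ha => Eventually.of_forall fun N =>
    ha.trans_le (cesaro_nonneg (fun n => by positivity) N), fun ε hε => ?_⟩
  obtain ⟨j, hj⟩ := exists_nat_one_div_lt (by positivity : 0 < ε / 3 / (C + 1))
  have h2 := hd.tendsto_cesaro.eventually
    (eventually_le_nhds (by have := hM0 j; positivity : 0 < ε / 3 / (M j + 1)))
  filter_upwards [hx j, h2] with N h3 h4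
  have h5 : cesaro (fun n => ‖d n‖ * ‖g (T^[n] x)‖) N ≤
      cesaro (fun n => (C + 1) * ‖g (T^[n] x) - g' j (T^[n] x)‖ + (M j + 1) * ‖d n‖) N := by
    refine cesaro_mono (fun n _ => ?_) N
    have h6 : ‖g (T^[n] x)‖ ≤ ‖g (T^[n] x) - g' j (T^[n] x)‖ + (M j + 1) := by
      have := norm_add_le (g (T^[n] x) - g' j (T^[n] x)) (g' j (T^[n] x))
      rw [sub_add_cancel] at this
      linarith [hM j (T^[n] x)]
    calc ‖d n‖ * ‖g (T^[n] x)‖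
        ≤ ‖d n‖ * (‖g (T^[n] x) - g' j (T^[n] x)‖ + (M j + 1)) := by gcongr
      _ = ‖d n‖ * ‖g (T^[n] x) - g' j (T^[n] x)‖ + (M j + 1) * ‖d n‖ := by ring
      _ ≤ _ := by
        gcongr
        linarith [hC n]
  rw [cesaro_add, cesaro_const_mul, cesaro_const_mul] at h5
  have h7 := h3.trans hj.le
  have hM1 : 0 < M j + 1 := by linarith [hM0 j]
  rw [le_div_iff₀ (by positivity)] at h7
  rw [le_div_iff₀ hM1] at h4
  have h8 : cesaro (fun n => ‖g (T^[n] x) - g' j (T^[n] x)‖) N * (C + 1) ≤ ε / 3 := h7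
  linarith

/-- The Banach principle for weighted ergodic averages with bounded weights: functions with
almost everywhere convergent averages form an `L¹`-closed set. -/
theorem weightedConverges_of_forall_approx (hT : Ergodic T μ) {d : ℕ → ℂ} {C : ℝ}
    (hC : ∀ n, ‖d n‖ ≤ C) {g : X → ℂ} (hm : Measurable g) (hg : Integrable g μ)
    (h : ∀ ε : ℝ, 0 < ε → ∃ g' : X → ℂ, Measurable g' ∧ Integrable g' μ ∧
      ∫ x, ‖g x - g' x‖ ∂μ < ε ∧ WeightedConverges T μ d g') :
    WeightedConverges T μ d g := by
  have hC0 : 0 ≤ C := (norm_nonneg _).trans (hC 0)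
  choose g' hm' hg' happ hconv using fun j : ℕ => h _ (by positivity : 0 < 1 / ((j : ℝ) + 1))
  have h1 := ae_all_iff.2 fun j => ae_eventually_cesaro_le hT (hm.sub (hm' j)).norm
    (hg.sub (hg' j)).norm (happ j)
  filter_upwards [h1, ae_all_iff.2 hconv] with x hx hx'
  refine exists_tendsto_of_forall_approx fun ε hε => ?_
  obtain ⟨j, hj⟩ := exists_nat_one_div_lt (by positivity : 0 < ε / (C + 1))
  refine ⟨_, hx' j, ?_⟩
  filter_upwards [hx j] with N h3
  rw [← cesaro_sub]
  refine (norm_cesaro_le _ N).trans ?_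
  have h5 : cesaro (fun n => ‖d n * g (T^[n] x) - d n * g' j (T^[n] x)‖) N ≤
      cesaro (fun n => (C + 1) * ‖g (T^[n] x) - g' j (T^[n] x)‖) N := by
    refine cesaro_mono (fun n _ => ?_) N
    rw [← mul_sub, norm_mul]
    gcongr
    linarith [hC n]
  rw [cesaro_const_mul] at h5
  have h7 := h3.trans hj.le
  rw [le_div_iff₀ (by positivity)] at h7
  have h8 : cesaro (fun n => ‖g (T^[n] x) - g' j (T^[n] x)‖) N * (C + 1) ≤ ε := h7
  linarith

theorem integral_norm_sub_le_norm_Lp_two (f g : Lp ℂ 2 μ) :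
    ∫ x, ‖f x - g x‖ ∂μ ≤ ‖f - g‖ := by
  have h1 : ∫ x, ‖f x - g x‖ ∂μ = ∫ x, ‖(f - g) x‖ ∂μ := by
    refine integral_congr_ae ?_
    filter_upwards [Lp.coeFn_sub f g] with x hx
    rw [hx, Pi.sub_apply]
  rw [h1, integral_norm_eq_lintegral_enorm (Lp.aestronglyMeasurable _), Lp.norm_def,
    ← eLpNorm_one_eq_lintegral_enorm]
  exact ENNReal.toReal_mono (Lp.eLpNorm_ne_top _)
    (eLpNorm_le_eLpNorm_of_exponent_le one_le_two (Lp.aestronglyMeasurable _))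

theorem integrable_Lp {p : ℝ≥0∞} [hp : Fact (1 ≤ p)] (f : Lp ℂ p μ) : Integrable f μ :=
  (Lp.memLp f).integrable hp.out

/-- For integrable `g`, `g (T^N x) / N → 0` almost everywhere: the bounded part of `g` is harmless,
and one term of a Cesàro sum of norms is at most the whole sum. -/
theorem ae_tendsto_iterate_div (hT : Ergodic T μ) {g : X → ℂ} (hm : Measurable g)
    (hg : Integrable g μ) :
    ∀ᵐ x ∂μ, Tendsto (fun N : ℕ => (N : ℝ)⁻¹ * ‖g (T^[N] x)‖) atTop (𝓝 0) := by
  choose M g' hM0 hm' hg' hM happ using fun j : ℕ =>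
    exists_bounded_approx hm hg (by positivity : 0 < 1 / ((j : ℝ) + 1))
  have h1 := ae_all_iff.2 fun j => ae_eventually_cesaro_le hT (hm.sub (hm' j)).norm
    (hg.sub (hg' j)).norm (happ j)
  filter_upwards [h1] with x hx
  refine tendsto_order.2 ⟨fun a ha => Eventually.of_forall fun N =>
    ha.trans_le (by positivity), fun ε hε => ?_⟩
  obtain ⟨j, hj⟩ := exists_nat_one_div_lt (by positivity : 0 < ε / 2)
  have h2 : Tendsto (fun N : ℕ => M j / N) atTop (𝓝 0) := tendsto_const_div_atTop_nhds_zero_nat _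
  filter_upwards [hx j, h2.eventually (gt_mem_nhds (half_pos hε)), eventually_gt_atTop 0]
    with N h3 h4 hN
  have h5 : ‖g (T^[N] x)‖ ≤
      ∑ n ∈ Finset.Icc 1 N, ‖g (T^[n] x) - g' j (T^[n] x)‖ + M j := by
    have h6 := norm_add_le (g (T^[N] x) - g' j (T^[N] x)) (g' j (T^[N] x))
    rw [sub_add_cancel] at h6
    have h7 := Finset.single_le_sum (f := fun n => ‖g (T^[n] x) - g' j (T^[n] x)‖)
      (fun n _ => norm_nonneg _) (Finset.mem_Icc.2 ⟨hN, le_refl N⟩)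
    linarith [hM j (T^[N] x)]
  calc (N : ℝ)⁻¹ * ‖g (T^[N] x)‖
      ≤ (N : ℝ)⁻¹ * (∑ n ∈ Finset.Icc 1 N, ‖g (T^[n] x) - g' j (T^[n] x)‖ + M j) := by gcongr
    _ = cesaro (fun n => ‖g (T^[n] x) - g' j (T^[n] x)‖) N + M j / N := by
      rw [cesaro, smul_eq_mul]; ring
    _ < ε := by
      have h8 : cesaro (fun n => ‖g (T^[n] x) - g' j (T^[n] x)‖) N ≤ 1 / ((j : ℝ) + 1) := h3
      linarith

theorem weightedConverges_of_coboundary (hT : Ergodic T μ) {c : ℂ} (hc : ‖c‖ = 1)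
    (f : Lp ℂ 2 μ) :
    WeightedConverges T μ (fun n => c ^ n)
      (c • koopman 2 hT.toMeasurePreserving f - f : Lp ℂ 2 μ) := by
  have hMP := hT.toMeasurePreserving
  have h1 : (fun x => c * f (T x) - f x) =ᵐ[μ] (c • koopman 2 hMP f - f : Lp ℂ 2 μ) := by
    filter_upwards [Lp.coeFn_sub (c • koopman 2 hMP f) f, Lp.coeFn_smul c (koopman 2 hMP f),
      koopman_coeFn hMP f] with x h2 h3 h4
    rw [h2, Pi.sub_apply, h3, Pi.smul_apply, h4, smul_eq_mul]
  refine WeightedConverges.congr hMP ?_ h1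
  have h2 := ae_tendsto_iterate_div hT (measurable_Lp f) (integrable_Lp f)
  filter_upwards [hMP.quasiMeasurePreserving.ae h2] with x hx
  have htel : ∀ N, ∑ n ∈ Finset.Icc 1 N, c ^ n * (c * f (T (T^[n] x)) - f (T^[n] x)) =
      c ^ (N + 1) * f (T^[N] (T x)) - c * f (T x) := fun N => by
    induction N with
    | zero => simp
    | succ N ih =>
      rw [Finset.sum_Icc_succ_top (by omega), ih, ← Function.iterate_succ_apply' T (N + 1) x,
        Function.iterate_succ_apply T (N + 1) x, Function.iterate_succ_apply T N x]
      ring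
  refine ⟨0, squeeze_zero_norm (fun N => ?_)
    (by simpa using hx.add (tendsto_const_div_atTop_nhds_zero_nat ‖f (T x)‖))⟩
  rw [cesaro, htel, norm_smul, Real.norm_of_nonneg (by positivity), div_eq_inv_mul, ← mul_add]
  gcongr
  refine (norm_sub_le _ _).trans ?_
  simp [hc]

/-- Pointwise convergence for the weights `c ^ n`, `|c| = 1`. By the mean ergodic theorem for the
contraction `U = c • koopman`, every `f ∈ L²` is a limit of sums of a fixed vector and a
coboundary `U h - h`. -/
theorem weightedConverges_pow (hT : Ergodic T μ) {c : ℂ} (hc : ‖c‖ = 1) (f : Lp ℂ 2 μ) :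
    WeightedConverges T μ (fun n => c ^ n) f := by
  have hMP := hT.toMeasurePreserving
  set U : Lp ℂ 2 μ →L[ℂ] Lp ℂ 2 μ := c • koopman 2 hMP with hU
  have hU1 : ‖U‖ ≤ 1 := U.opNorm_le_bound zero_le_one fun g => by
    simp [hU, norm_smul, hc, norm_koopman]
  have hlim := U.tendsto_birkhoffAverage_orthogonalProjection hU1 f
  set P : Lp ℂ 2 μ :=
    ((U.eqLocus (1 : Lp ℂ 2 μ →L[ℂ] Lp ℂ 2 μ)).orthogonalProjectionOnto f).1 with hP
  have hPfix : c • koopman 2 hMP P = P := by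
    have h1 : P ∈ U.eqLocus (1 : Lp ℂ 2 μ →L[ℂ] Lp ℂ 2 μ) := Submodule.coe_mem _
    exact h1
  have hcob : ∀ M : ℕ, 0 < M → ∃ g, U g - g = f - birkhoffAverage ℂ U _root_.id M f := by
    intro M hM
    have h1 : ∀ i : ℕ, f - U^[i] f ∈
        LinearMap.range ((U - 1 : Lp ℂ 2 μ →L[ℂ] Lp ℂ 2 μ) : Lp ℂ 2 μ →ₗ[ℂ] Lp ℂ 2 μ) := by
      intro i
      induction i with
      | zero => simp
      | succ i ih =>
        have h2 : f - U^[i + 1] f = (f - U^[i] f) + (U - 1) (-(U^[i] f)) := by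
          rw [Function.iterate_succ_apply']
          simp only [sub_apply, map_neg, one_apply_eq_self]
          abel
        rw [h2]
        exact add_mem ih ⟨_, rfl⟩
    have hM' : (M : ℂ) ≠ 0 := by exact_mod_cast hM.ne'
    have h3 : f - birkhoffAverage ℂ U _root_.id M f =
        (M : ℂ)⁻¹ • ∑ i ∈ Finset.range M, (f - U^[i] f) := by
      rw [Finset.sum_sub_distrib, smul_sub, Finset.sum_const, Finset.card_range,
        ← Nat.cast_smul_eq_nsmul ℂ, smul_smul, inv_mul_cancel₀ hM', one_smul]
      rfl
    rw [h3]
    obtain ⟨g, hg⟩ := Submodule.smul_mem _ (M : ℂ)⁻¹ (Submodule.sum_mem _ fun i _ => h1 i)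
    exact ⟨g, hg⟩
  refine weightedConverges_of_forall_approx (C := 1) hT (fun n => by simp [hc]) (measurable_Lp f)
    (integrable_Lp f) fun ε hε => ?_
  obtain ⟨M, hM, hM0⟩ := ((hlim.eventually (Metric.ball_mem_nhds P hε)).and
    (eventually_gt_atTop 0)).exists
  obtain ⟨g, hg⟩ := hcob M hM0
  refine ⟨(P + (U g - g) : Lp ℂ 2 μ), measurable_Lp _, integrable_Lp _, ?_, ?_⟩
  · refine (integral_norm_sub_le_norm_Lp_two _ _).trans_lt ?_
    have h1 : f - (P + (U g - g)) = birkhoffAverage ℂ U _root_.id M f - P := by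
      rw [hg]; abel
    rw [h1, ← dist_eq_norm]
    exact hM
  · exact ((weightedConverges_of_fixed hMP hPfix).add
      (weightedConverges_of_coboundary hT hc g)).congr hMP (Lp.coeFn_add _ _).symm

theorem weightedConverges_of_mem_trigPoly (hT : Ergodic T μ) {q : ℕ → ℂ} (hq : q ∈ trigPoly)
    (f : Lp ℂ 2 μ) : WeightedConverges T μ q f := by
  induction hq using Submodule.span_induction with
  | mem u hu =>
    obtain ⟨c, hc, rfl⟩ := hu
    exact weightedConverges_pow hT hc f
  | zero => exact ae_of_all _ fun x => ⟨0, tendsto_const_nhds.congr fun N => by simp [cesaro]⟩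
  | add u v _ _ hu hv =>
    filter_upwards [hu, hv] with x ⟨a, ha⟩ ⟨b, hb⟩
    refine ⟨a + b, (ha.add hb).congr fun N => ?_⟩
    rw [← cesaro_add]
    simp only [Pi.add_apply, add_mul]
  | smul a u _ hu =>
    filter_upwards [hu] with x ⟨b, hb⟩
    refine ⟨a * b, (hb.const_mul a).congr fun N => ?_⟩
    simp only [cesaro, Pi.smul_apply, smul_eq_mul, mul_assoc, ← Finset.mul_sum,
      mul_smul_comm]

/-- For a bounded function, weights close in the Besicovitch seminorm give close averages;
integrable functions follow by the Banach principle. -/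
theorem IsBesicovitch.weightedConverges (hT : Ergodic T μ) {d : ℕ → ℂ} (hd : IsBesicovitch d)
    {g : X → ℂ} (hm : Measurable g) (hg : Integrable g μ) : WeightedConverges T μ d g := by
  obtain ⟨⟨C, hC⟩, hd⟩ := hd
  refine weightedConverges_of_forall_approx hT hC hm hg fun ε hε => ?_
  obtain ⟨M, g', hM0, hm', hg', hM, happ⟩ := exists_bounded_approx hm hg hε
  refine ⟨g', hm', hg', happ, ?_⟩
  have hL2 : MemLp g' 2 μ := MemLp.of_bound hm'.aestronglyMeasurable M (ae_of_all _ hM)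
  choose q hq hdq using fun j : ℕ => hd (1 / ((j : ℝ) + 1)) (by positivity)
  filter_upwards [ae_all_iff.2 fun j => (weightedConverges_of_mem_trigPoly hT (hq j)
    (hL2.toLp g')).congr hT.toMeasurePreserving hL2.coeFn_toLp] with x hx
  refine exists_tendsto_of_forall_approx fun δ hδ => ?_
  obtain ⟨j, hj⟩ := exists_nat_one_div_lt (by positivity : 0 < δ / (M + 1))
  refine ⟨_, hx j, ?_⟩
  filter_upwards [hdq j] with N h3
  rw [← cesaro_sub]
  refine (norm_cesaro_le _ N).trans ?_
  have h5 : cesaro (fun n => ‖d n * g' (T^[n] x) - q j n * g' (T^[n] x)‖) N ≤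
      cesaro (fun n => (M + 1) * ‖d n - q j n‖) N := by
    refine cesaro_mono (fun n _ => ?_) N
    rw [← sub_mul, norm_mul, mul_comm]
    gcongr
    linarith [hM (T^[n] x)]
  rw [cesaro_const_mul] at h5
  have h7 := h3.trans hj.le
  rw [le_div_iff₀ (by positivity)] at h7
  linarith

end Weighted

/-! ### The Jacobs–Glicksberg–deLeeuw decomposition on `L²` -/

section Hilbert

open InnerProductSpace

variable {H : Type*} [NormedAddCommGroup H] [InnerProductSpace ℂ H] {S : H →L[ℂ] H}

/-- The average `N⁻¹ ∑_{n<N} |S^n f⟩⟨S^n f|` of rank one operators along the orbit of `f`. -/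
noncomputable def orbitOperator (S : H →L[ℂ] H) (f : H) (N : ℕ) : H →L[ℂ] H :=
  (N : ℂ)⁻¹ • ∑ n ∈ Finset.range N, rankOne ℂ ((S ^ n) f) ((S ^ n) f)

theorem inner_orbitOperator (f a b : H) (N : ℕ) :
    inner ℂ a (orbitOperator S f N b) =
      (N : ℂ)⁻¹ * ∑ n ∈ Finset.range N, inner ℂ a ((S ^ n) f) * inner ℂ ((S ^ n) f) b := by
  simp only [orbitOperator, smul_apply, sum_apply,
    rankOne_apply, inner_smul_right, inner_sum]
  congr 1
  exact Finset.sum_congr rfl fun n _ => mul_comm _ _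

theorem inner_orbitOperator_self (f b : H) (N : ℕ) :
    inner ℂ b (orbitOperator S f N b) =
      (((N : ℝ)⁻¹ * ∑ n ∈ Finset.range N, ‖inner ℂ b ((S ^ n) f)‖ ^ 2 : ℝ) : ℂ) := by
  rw [inner_orbitOperator, Complex.ofReal_mul, Complex.ofReal_inv, Complex.ofReal_natCast,
    Complex.ofReal_sum]
  congr 1
  refine Finset.sum_congr rfl fun n _ => ?_
  rw [← inner_conj_symm ((S ^ n) f) b, Complex.mul_conj', Complex.ofReal_pow]

theorem isSymmetric_orbitOperator (f : H) (N : ℕ) :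
    (orbitOperator S f N : H →ₗ[ℂ] H).IsSymmetric := by
  intro a b
  simp only [ContinuousLinearMap.coe_coe]
  rw [← inner_conj_symm, inner_orbitOperator, inner_orbitOperator, map_mul, map_sum]
  simp only [map_mul, inner_conj_symm, map_inv₀, map_natCast]
  congr 1
  exact Finset.sum_congr rfl fun n _ => mul_comm _ _

theorem isCompactOperator_orbitOperator [CompleteSpace H] (f : H) (N : ℕ) :
    IsCompactOperator (orbitOperator S f N) := by
  have h1 : ∀ x : H, IsCompactOperator (rankOne ℂ x x) := fun x => by
    rw [rankOne_def']
    exact (isCompactOperator_of_locallyCompactSpace_rng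
      (ContinuousLinearMap.toSpanSingleton ℂ x)).comp_clm (innerSL ℂ x)
  have h2 : orbitOperator S f N ∈ compactOperator (RingHom.id ℂ) H H :=
    Submodule.smul_mem _ _ (Submodule.sum_mem _ fun n _ => h1 _)
  exact h2

/-- In the limit, the orbit operators commute with `S`: for an isometry `S`, the operators
`r n = |S^n f⟩⟨S^n f|` satisfy `r (n + 1) ∘ S = S ∘ r n`, so the commutator telescopes. -/
theorem tendsto_commutator_orbitOperator (hS : ∀ f, ‖S f‖ = ‖f‖) (f b : H) :
    Tendsto (fun N => orbitOperator S f N (S b) - S (orbitOperator S f N b)) atTop (𝓝 0) := by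
  have hin : ∀ x y : H, inner ℂ (S x) (S y) = inner ℂ x y :=
    (LinearMap.norm_map_iff_inner_map_map (S : H →ₗ[ℂ] H)).1 hS
  have key : ∀ N, orbitOperator S f N (S b) - S (orbitOperator S f N b) =
      (N : ℂ)⁻¹ • (rankOne ℂ f f (S b) - rankOne ℂ ((S ^ N) f) ((S ^ N) f) (S b)) := fun N => by
    have h1 : ∀ n, S (rankOne ℂ ((S ^ n) f) ((S ^ n) f) b) =
        rankOne ℂ ((S ^ (n + 1)) f) ((S ^ (n + 1)) f) (S b) := fun n => by
      simp only [rankOne_apply, pow_succ', mul_apply_eq_comp, hin, map_smul]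
    simp only [orbitOperator, smul_apply, sum_apply,
      map_smul, map_sum, h1, ← smul_sub, ← Finset.sum_sub_distrib]
    rw [Finset.sum_range_sub' fun n => rankOne ℂ ((S ^ n) f) ((S ^ n) f) (S b)]
    simp
  refine squeeze_zero_norm (fun N => ?_)
    (tendsto_const_div_atTop_nhds_zero_nat (‖f‖ * ‖f‖ * ‖b‖ + ‖f‖ * ‖f‖ * ‖b‖))
  have h2 : ∀ n, ‖rankOne ℂ ((S ^ n) f) ((S ^ n) f) (S b)‖ ≤ ‖f‖ * ‖f‖ * ‖b‖ := fun n => by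
    refine (ContinuousLinearMap.le_opNorm _ _).trans ?_
    have h3 := norm_pow_apply_le (fun f => (hS f).le) n f
    rw [norm_rankOne, hS]
    gcongr
  rw [key, norm_smul, norm_inv, Complex.norm_natCast, div_eq_inv_mul]
  gcongr
  exact (norm_sub_le _ _).trans (add_le_add (by simpa using h2 0) (h2 N))

theorem inner_pow_eq_zero_of_eigenvector (hS : ∀ f, ‖S f‖ = ‖f‖) {f v : H} {c : ℂ}
    (hc : ‖c‖ = 1) (hv : S v = c • v) (hf : inner ℂ v f = 0) (n : ℕ) :
    inner ℂ v ((S ^ n) f) = 0 := by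
  induction n with
  | zero => simpa using hf
  | succ n ih =>
    have hin : inner ℂ (S v) (S ((S ^ n) f)) = inner ℂ v ((S ^ n) f) :=
      (LinearMap.norm_map_iff_inner_map_map (S : H →ₗ[ℂ] H)).1 hS v _
    rw [ih, hv, inner_smul_left, mul_eq_zero] at hin
    rw [pow_succ', mul_apply_eq_comp]
    refine hin.resolve_left fun h0 => ?_
    rw [map_eq_zero] at h0
    simp [h0] at hc

/-- A vector orthogonal to the unimodular eigenvectors of an isometry has mean square null
correlations, provided its orbit operators converge in norm. The limit is compact, symmetric and
commutes with `S`. A nonzero limit would have a nonzero finite-dimensional `S`-invariant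
eigenspace, hence an eigenvector of `S` in it; but the limit kills all eigenvectors of `S`. -/
theorem tendsto_orbitOperator_zero [CompleteSpace H] (hS : ∀ f, ‖S f‖ = ‖f‖) {f : H}
    (hf : ∀ (v : H) (c : ℂ), ‖c‖ = 1 → S v = c • v → inner ℂ v f = 0)
    (hC : CauchySeq (orbitOperator S f)) :
    Tendsto (orbitOperator S f) atTop (𝓝 0) := by
  obtain ⟨B, hB⟩ := cauchySeq_tendsto_of_complete hC
  have happ : ∀ b, Tendsto (fun N => orbitOperator S f N b) atTop (𝓝 (B b)) := fun b =>
    ((ContinuousLinearMap.apply ℂ H b).continuous.tendsto B).comp hB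
  have hcomp : IsCompactOperator B :=
    isCompactOperator_of_tendsto hB (Eventually.of_forall (isCompactOperator_orbitOperator f))
  have hsymm : (B : H →ₗ[ℂ] H).IsSymmetric := fun a b =>
    tendsto_nhds_unique ((happ a).inner tendsto_const_nhds)
      ((tendsto_const_nhds.inner (happ b)).congr fun N => (isSymmetric_orbitOperator f N a b).symm)
  have hcomm : ∀ b, B (S b) = S (B b) := fun b => by
    have h1 := (happ (S b)).sub ((S.continuous.tendsto _).comp (happ b))
    exact sub_eq_zero.1 (tendsto_nhds_unique h1 (tendsto_commutator_orbitOperator hS f b))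
  have hkill : ∀ (v : H) (c : ℂ), ‖c‖ = 1 → S v = c • v → B v = 0 := fun v c hc hv => by
    refine tendsto_nhds_unique (happ v) (tendsto_const_nhds.congr fun N => ?_)
    have h1 : ∀ n, inner ℂ ((S ^ n) f) v = 0 := fun n => by
      rw [← inner_conj_symm, inner_pow_eq_zero_of_eigenvector hS hc hv (hf v c hc hv), map_zero]
    simp only [orbitOperator, smul_apply, sum_apply, rankOne_apply, h1, zero_smul,
      Finset.sum_const_zero, smul_zero]
  suffices hB0 : B = 0 by rwa [hB0] at hB
  refine (ContinuousLinearMap.eq_zero_of_forall_hasEigenvalue_eq_zero hcomp hsymm).1 fun l hl => ?_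
  by_contra hl0
  have hfin := ContinuousLinearMap.finite_dimensional_eigenspace hcomp l hl0
  set V := Module.End.eigenspace (B : H →ₗ[ℂ] H) l with hV
  have hinv : ∀ v ∈ V, S v ∈ V := fun v hv => by
    rw [hV, Module.End.mem_eigenspace_iff] at hv ⊢
    rw [ContinuousLinearMap.coe_coe] at hv ⊢
    rw [hcomm, hv, map_smul]
  have hnt : Nontrivial V := by
    rw [Submodule.nontrivial_iff_ne_bot]
    exact hl
  obtain ⟨c, hc⟩ := Module.End.exists_eigenvalue ((S : H →ₗ[ℂ] H).restrict hinv)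
  obtain ⟨v, hv⟩ := hc.exists_hasEigenvector
  have hv1 : S v = c • (v : H) := congrArg Subtype.val hv.apply_eq_smul
  have hv0 : (v : H) ≠ 0 := fun h => hv.2 (Subtype.ext h)
  have hc1 : ‖c‖ = 1 := by
    have h1 := hS v
    rw [hv1, norm_smul] at h1
    exact mul_right_cancel₀ (norm_ne_zero_iff.2 hv0) (h1.trans (one_mul _).symm)
  have h2 : B v = l • (v : H) := Module.End.mem_eigenspace_iff.1 v.2
  rw [hkill v c hc1 hv1] at h2
  exact (smul_ne_zero hl0 hv0) h2.symm

theorem isCesaroNull_of_orthogonal [CompleteSpace H] (hS : ∀ f, ‖S f‖ = ‖f‖) {f : H}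
    (hf : ∀ (v : H) (c : ℂ), ‖c‖ = 1 → S v = c • v → inner ℂ v f = 0)
    (hC : CauchySeq (orbitOperator S f)) (φ : StrongDual ℂ H) :
    IsCesaroNull fun n => φ ((S ^ n) f) := by
  refine ⟨⟨‖φ‖ * ‖f‖, fun n => (φ.le_opNorm _).trans ?_⟩, ?_⟩
  · gcongr
    exact norm_pow_apply_le (fun f => (hS f).le) n f
  -- The sum over `1 ≤ n ≤ N` is the sum over `n < N` for the functional `φ ∘ S`.
  set b : H := (toDual ℂ H).symm (φ.comp S) with hb
  have hφ : ∀ n, φ ((S ^ (n + 1)) f) = inner ℂ b ((S ^ n) f) := fun n => by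
    rw [hb, toDual_symm_apply, pow_succ', mul_apply_eq_comp]
    rfl
  have hlim : Tendsto (fun N : ℕ => (N : ℝ)⁻¹ * ∑ n ∈ Finset.range N,
      ‖inner ℂ b ((S ^ n) f)‖ ^ 2) atTop (𝓝 0) := by
    have h1 : Tendsto (fun N => orbitOperator S f N b) atTop (𝓝 0) :=
      ((ContinuousLinearMap.apply ℂ H b).continuous.tendsto 0).comp
        (tendsto_orbitOperator_zero hS hf hC)
    have h2 := (tendsto_const_nhds (x := b)).inner (𝕜 := ℂ) h1
    simp only [inner_orbitOperator_self, inner_zero_right] at h2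
    exact (Complex.continuous_re.tendsto 0).comp h2
  refine squeeze_zero (fun N => by positivity) (fun N => ?_)
    (by simpa only [Real.sqrt_zero] using hlim.sqrt)
  refine Real.le_sqrt_of_sq_le ?_
  have h3 : ∑ n ∈ Finset.Icc 1 N, ‖φ ((S ^ n) f)‖ =
      ∑ n ∈ Finset.range N, ‖inner ℂ b ((S ^ n) f)‖ := by
    clear_value b
    induction N with
    | zero => simp
    | succ N ih => rw [Finset.sum_Icc_succ_top (by omega), ih, Finset.sum_range_succ, hφ]
  have h4 := sq_sum_le_card_mul_sum_sq (s := Finset.range N)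
    (f := fun n => ‖inner ℂ b ((S ^ n) f)‖)
  rw [Finset.card_range] at h4
  rw [h3, one_div, mul_pow]
  rcases Nat.eq_zero_or_pos N with rfl | hN
  · simp
  have hN' : (0 : ℝ) < N := by exact_mod_cast hN
  calc ((N : ℝ)⁻¹) ^ 2 * (∑ n ∈ Finset.range N, ‖inner ℂ b ((S ^ n) f)‖) ^ 2
      ≤ ((N : ℝ)⁻¹) ^ 2 * (N * ∑ n ∈ Finset.range N, ‖inner ℂ b ((S ^ n) f)‖ ^ 2) := by gcongr
    _ = _ := by field_simp

end Hilbert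

section LTwo

variable {X : Type*} [MeasurableSpace X] {μ : Measure X} {T : X → X}

theorem memLp_tensor (u v : Lp ℂ 2 μ) :
    MemLp (fun z : X × X => u z.1 * star (v z.2)) 2 (μ.prod μ) := by
  have hm : AEStronglyMeasurable (fun z : X × X => u z.1 * star (v z.2)) (μ.prod μ) :=
    (((measurable_Lp u).comp measurable_fst).mul
      (continuous_star.measurable.comp
        ((measurable_Lp v).comp measurable_snd))).aestronglyMeasurable
  rw [memLp_two_iff_integrable_sq_norm hm]
  simp only [norm_mul, norm_star, mul_pow]
  exact ((memLp_two_iff_integrable_sq_norm (Lp.aestronglyMeasurable u)).1 (Lp.memLp u)).mul_prod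
    ((memLp_two_iff_integrable_sq_norm (Lp.aestronglyMeasurable v)).1 (Lp.memLp v))

/-- The element `u ⊗ v̄` of `L²(μ × μ)`, the Hilbert–Schmidt kernel of the operator
`|u⟩⟨v|`. -/
noncomputable def tensor (u v : Lp ℂ 2 μ) : Lp ℂ 2 (μ.prod μ) :=
  (memLp_tensor u v).toLp

theorem tensor_coeFn (u v : Lp ℂ 2 μ) :
    tensor u v =ᵐ[μ.prod μ] fun z : X × X => u z.1 * star (v z.2) :=
  (memLp_tensor u v).coeFn_toLp

variable [IsProbabilityMeasure μ]

theorem inner_tensor (a b u v : Lp ℂ 2 μ) :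
    inner ℂ (tensor a b) (tensor u v) = inner ℂ a u * inner ℂ v b := by
  have h1 : inner ℂ (tensor a b) (tensor u v) =
      ∫ z : X × X, inner ℂ (a z.1) (u z.1) * inner ℂ (v z.2) (b z.2) ∂(μ.prod μ) := by
    rw [L2.inner_def]
    refine integral_congr_ae ?_
    filter_upwards [tensor_coeFn a b, tensor_coeFn u v] with z h1 h2
    rw [h1, h2]
    simp only [RCLike.inner_apply, map_mul, Complex.star_def, Complex.conj_conj]
    ring
  rw [h1, integral_prod_mul (fun x => inner ℂ (a x) (u x)) (fun x => inner ℂ (v x) (b x)),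
    L2.inner_def, L2.inner_def]

theorem norm_tensor (a b : Lp ℂ 2 μ) : ‖tensor a b‖ = ‖a‖ * ‖b‖ := by
  have h1 := inner_tensor a b a b
  rw [inner_self_eq_norm_sq_to_K, inner_self_eq_norm_sq_to_K, inner_self_eq_norm_sq_to_K] at h1
  have h2 : ‖tensor a b‖ ^ 2 = (‖a‖ * ‖b‖) ^ 2 := by
    rw [mul_pow]
    exact_mod_cast h1
  exact (pow_left_inj₀ (norm_nonneg _) (by positivity) two_ne_zero).1 h2

theorem koopman_tensor (hT : MeasurePreserving T μ μ) (u v : Lp ℂ 2 μ) :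
    koopman 2 (hT.prod hT) (tensor u v) = tensor (koopman 2 hT u) (koopman 2 hT v) := by
  refine Lp.ext ?_
  filter_upwards [koopman_coeFn (hT.prod hT) (tensor u v),
    (hT.prod hT).quasiMeasurePreserving.ae (tensor_coeFn u v),
    tensor_coeFn (koopman 2 hT u) (koopman 2 hT v),
    Measure.quasiMeasurePreserving_fst.ae (koopman_coeFn hT u),
    Measure.quasiMeasurePreserving_snd.ae (koopman_coeFn hT v)] with z h1 h2 h3 h4 h5
  rw [h1, h2, h3, h4, h5]
  rfl

/-- Convergence of the orbit operators in the Hilbert–Schmidt norm is the mean ergodic theorem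
for `T × T` on `L²(μ × μ)`. -/
theorem cauchySeq_orbitOperator (hT : MeasurePreserving T μ μ) (f : Lp ℂ 2 μ) :
    CauchySeq (orbitOperator (koopman 2 hT) f) := by
  set U := koopman 2 (hT.prod hT) with hU
  set K : ℕ → Lp ℂ 2 (μ.prod μ) := fun N => birkhoffAverage ℂ U _root_.id N (tensor f f) with hK
  have hKC : CauchySeq K := (U.tendsto_birkhoffAverage_orthogonalProjection
    (U.opNorm_le_bound zero_le_one fun g => by simp [hU, norm_koopman]) (tensor f f)).cauchySeq
  have hpow : ∀ n : ℕ, U^[n] (tensor f f) =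
      tensor ((koopman 2 hT ^ n) f) ((koopman 2 hT ^ n) f) := fun n => by
    induction n with
    | zero => simp
    | succ n ih =>
      rw [Function.iterate_succ_apply', ih, hU, koopman_tensor, pow_succ', mul_apply_eq_comp]
  have hinner : ∀ a b N, inner ℂ a (orbitOperator (koopman 2 hT) f N b) =
      inner ℂ (tensor a b) (K N) := fun a b N => by
    simp only [hK, birkhoffAverage, birkhoffSum, _root_.id, hpow, inner_smul_right, inner_sum,
      inner_tensor, inner_orbitOperator]
  rw [Metric.cauchySeq_iff'] at hKC ⊢
  intro ε hε
  obtain ⟨N, hN⟩ := hKC ε hε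
  refine ⟨N, fun n hn => lt_of_le_of_lt ?_ (hN n hn)⟩
  rw [dist_eq_norm, dist_eq_norm]
  refine ContinuousLinearMap.opNorm_le_bound _ (norm_nonneg _) fun b => ?_
  -- The operator norm is at most the Hilbert–Schmidt norm.
  set w := (orbitOperator (koopman 2 hT) f n - orbitOperator (koopman 2 hT) f N) b with hw
  have h1 : inner ℂ w w = inner ℂ (tensor w b) (K n - K N) := by
    rw [inner_sub_right, ← hinner, ← hinner, ← inner_sub_right, hw, sub_apply]
  have h2 := norm_inner_le_norm (𝕜 := ℂ) (tensor w b) (K n - K N)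
  rw [← h1, norm_tensor, inner_self_eq_norm_sq_to_K, norm_pow, RCLike.norm_ofReal, abs_norm] at h2
  rcases eq_or_ne w 0 with h0 | h0
  · rw [h0, norm_zero]
    positivity
  · have h3 : 0 < ‖w‖ := norm_pos_iff.2 h0
    refine le_of_mul_le_mul_left ?_ h3
    linarith [sq ‖w‖]

/-- On `L²`, correlation sequences of a Koopman operator are Besicovitch almost periodic: the
reversible part contributes an almost periodic sequence and its orthogonal complement a Cesàro
null one. -/
theorem isBesicovitch_koopman (hT : MeasurePreserving T μ μ) (f : Lp ℂ 2 μ)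
    (φ : StrongDual ℂ (Lp ℂ 2 μ)) : IsBesicovitch fun n => φ ((koopman 2 hT ^ n) f) := by
  set V := reversiblePart (koopman 2 hT) with hV
  have : CompleteSpace V := (Submodule.isClosed_topologicalClosure _).completeSpace_coe
  obtain ⟨r, hr, s, hs, rfl⟩ := V.exists_add_mem_mem_orthogonal f
  have h1 := isBesicovitch_of_mem_reversiblePart (fun f => (norm_koopman hT f).le) hr φ
  have h2 := (isCesaroNull_of_orthogonal (norm_koopman hT)
    (fun v c hc hv => hs v (Submodule.le_topologicalClosure _ (Submodule.subset_span ⟨c, hc, hv⟩)))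
    (cauchySeq_orbitOperator hT s) φ).isBesicovitch
  simp only [map_add]
  exact h1.add h2

end LTwo

/-! ### Expansion of entangled products -/

section Expansion

variable {X : Type*} [MeasurableSpace X] {μ : Measure X} {p : ℝ≥0∞} [Fact (1 ≤ p)]

theorem ae_norm_le_of_eLpNorm_top_le {g : X → ℂ} {ε : ℝ} (hε : 0 ≤ ε)
    (h : eLpNorm g ∞ μ ≤ ENNReal.ofReal ε) : ∀ᵐ x ∂μ, ‖g x‖ ≤ ε := by
  rw [eLpNorm_exponent_top] at h
  filter_upwards [enorm_ae_le_eLpNormEssSup g μ] with x hx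
  have h1 := hx.trans h
  rwa [← ofReal_norm, ENNReal.ofReal_le_ofReal_iff hε] at h1

theorem LinftyBoundedBy.ae_norm_le {C : ℝ} (hC : 0 ≤ C) {B : Lp ℂ p μ →L[ℂ] Lp ℂ p μ}
    (hB : LinftyBoundedBy C B) {g : Lp ℂ p μ} {ε : ℝ} (hε : 0 ≤ ε)
    (hg : ∀ᵐ x ∂μ, ‖g x‖ ≤ ε) : ∀ᵐ x ∂μ, ‖B g x‖ ≤ C * ε := by
  have h1 : eLpNorm g ∞ μ ≤ ENNReal.ofReal ε := by
    rw [eLpNorm_exponent_top]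
    exact eLpNormEssSup_le_of_ae_bound hg
  refine ae_norm_le_of_eLpNorm_top_le (by positivity) ?_
  refine (hB g ⟨Lp.aestronglyMeasurable g, h1.trans_lt ENNReal.ofReal_lt_top⟩).trans ?_
  rw [ENNReal.ofReal_mul hC]
  gcongr

/-- Coordinates on the finite-dimensional summand turn twisted compactness into a uniform
approximation of the orbit `A (S ^ n f)` by finitely many vectors, with coefficients that are
correlation sequences of `f`. -/
theorem TwistedCompact.exists_expansion {A S : Lp ℂ p μ →L[ℂ] Lp ℂ p μ}
    (h : TwistedCompact A S) (f : Lp ℂ p μ) {ε : ℝ} (hε : 0 < ε) :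
    ∃ (r : ℕ) (φ : Fin r → StrongDual ℂ (Lp ℂ p μ)) (g : Fin r → Lp ℂ p μ),
      ∀ n : ℕ, 1 ≤ n →
        ∀ᵐ x ∂μ, ‖(A ((S ^ n) f) - ∑ i, φ i ((S ^ n) f) • g i : Lp ℂ p μ) x‖ ≤ ε := by
  obtain ⟨U, R, hUR, hfin, hR, hn⟩ := h f ε hε
  have htop : Submodule.IsTopCompl U R :=
    (Submodule.IsCompl.isTopCompl_of_isClosed_of_finiteDimensional hUR hR).symm
  set b := Module.finBasis ℂ U with hb
  refine ⟨_, fun i => ((LinearMap.toContinuousLinearMap (b.coord i)).comp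
    (U.projectionOntoL R htop)).comp A, fun i => b i, fun n hn1 => ?_⟩
  have h1 : (A ((S ^ n) f) - ∑ i, (((LinearMap.toContinuousLinearMap (b.coord i)).comp
      (U.projectionOntoL R htop)).comp A) ((S ^ n) f) • (b i : Lp ℂ p μ)) =
      R.projection U hUR (A ((S ^ n) f)) := by
    have h2 : ∑ i, (((LinearMap.toContinuousLinearMap (b.coord i)).comp
        (U.projectionOntoL R htop)).comp A) ((S ^ n) f) • (b i : Lp ℂ p μ) =
        U.projection R hUR.symm (A ((S ^ n) f)) := by
      have h3 := congrArg U.subtype (b.sum_repr (U.projectionOntoL R htop (A ((S ^ n) f))))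
      simp only [map_sum, map_smul] at h3
      exact h3
    rw [h2, sub_eq_iff_eq_add]
    exact (Submodule.projection_add_projection_eq_self hUR _).symm
  rw [h1]
  exact ae_norm_le_of_eLpNorm_top_le hε.le (hn n hn1)

/-- A family `F n`, `n ∈ ℕ^k`, of `L^p` functions is expandable with terms in `P` if it is
uniformly close in `L^∞`, for multi-indices with positive entries, to finite sums
`∑ᵢ (∏ₗ dᵢ l (n l)) • gᵢ` whose terms satisfy `P dᵢ gᵢ`. -/
def Expandable {k : ℕ} (P : (Fin k → ℕ → ℂ) → Lp ℂ p μ → Prop) (F : (Fin k → ℕ) → Lp ℂ p μ) :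
    Prop :=
  ∀ ε : ℝ, 0 < ε → ∃ (ι : Type) (_ : Fintype ι) (d : ι → Fin k → ℕ → ℂ) (g : ι → Lp ℂ p μ),
    (∀ i, P (d i) (g i)) ∧ ∀ n : Fin k → ℕ, (∀ l, 1 ≤ n l) →
      ∀ᵐ x ∂μ, ‖(F n - ∑ i, (∏ l, d i l (n l)) • g i : Lp ℂ p μ) x‖ ≤ ε

/-- The coefficient system obtained from `d` by multiplying the sequence at index `l₀` by `s`. -/
def mulAt {k : ℕ} (d : Fin k → ℕ → ℂ) (l₀ : Fin k) (s : ℕ → ℂ) : Fin k → ℕ → ℂ :=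
  fun l n => d l n * if l = l₀ then s n else 1

theorem prod_mulAt {k : ℕ} (d : Fin k → ℕ → ℂ) (l₀ : Fin k) (s : ℕ → ℂ) (n : Fin k → ℕ) :
    ∏ l, mulAt d l₀ s l (n l) = (∏ l, d l (n l)) * s (n l₀) := by
  simp only [mulAt, Finset.prod_mul_distrib, Finset.prod_ite_eq', Finset.mem_univ, if_true]

theorem mulAt_self {k : ℕ} (d : Fin k → ℕ → ℂ) (l₀ : Fin k) (s : ℕ → ℂ) :
    mulAt d l₀ s l₀ = d l₀ * s := by
  ext n
  simp [mulAt]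

theorem mulAt_of_ne {k : ℕ} (d : Fin k → ℕ → ℂ) {l l₀ : Fin k} (s : ℕ → ℂ) (h : l ≠ l₀) :
    mulAt d l₀ s l = d l := by
  ext n
  simp [mulAt, h]

/-- Applying `A ∘ S ^ (n l₀)` preserves expandability: the terms are expanded by twisted
compactness, and the error stays small by the `L^∞`-bound. -/
theorem Expandable.step {k : ℕ} {P P' : (Fin k → ℕ → ℂ) → Lp ℂ p μ → Prop}
    {F : (Fin k → ℕ) → Lp ℂ p μ} (hF : Expandable P F) {A S : Lp ℂ p μ →L[ℂ] Lp ℂ p μ}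
    (hA1 : TwistedCompact A S) {C : ℝ} (hC : 0 < C)
    (hA2 : ∀ n : ℕ, 1 ≤ n → LinftyBoundedBy C (A.comp (S ^ n))) (l₀ : Fin k)
    (hb : ∀ d g, P d g → ∀ l, ∃ K : ℝ, ∀ n, ‖d l n‖ ≤ K)
    (hP : ∀ d g (φ : StrongDual ℂ (Lp ℂ p μ)) g', P d g →
      P' (mulAt d l₀ fun n => φ ((S ^ n) g)) g') :
    Expandable P' fun n => A ((S ^ n l₀) (F n)) := by
  intro ε hε
  obtain ⟨ι, _, d, g, hd, happ⟩ := hF (ε / (2 * C)) (by positivity)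
  choose K hK using fun i => hb (d i) (g i) (hd i)
  have hK0 : ∀ i l, 0 ≤ K i l := fun i l => (norm_nonneg _).trans (hK i l 0)
  have hKp : ∀ i, 0 ≤ ∏ l, K i l := fun i => Finset.prod_nonneg fun l _ => hK0 i l
  -- Half of `ε` pays for the old error, which grows by `C`; the other half is shared by the terms,
  -- whose coefficients are at most `∏ l, K i l`. Adding `1` keeps the divisors positive.
  set c : ℝ := Fintype.card ι + 1 with hc
  have hc0 : 0 < c := by positivity
  choose r φ g' hg' using fun i => hA1.exists_expansion (g i)
    (ε := ε / (2 * c * (∏ l, K i l + 1))) (by have := hKp i; positivity)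
  refine ⟨Σ i, Fin (r i), inferInstance, fun q => mulAt (d q.1) l₀ fun n => φ q.1 q.2 ((S ^ n) (g q.1)),
    fun q => g' q.1 q.2, fun q => hP _ _ _ _ (hd q.1), fun n hn => ?_⟩
  set E : ι → Lp ℂ p μ := fun i =>
    A ((S ^ n l₀) (g i)) - ∑ j, φ i j ((S ^ n l₀) (g i)) • g' i j with hE
  set D : Lp ℂ p μ := F n - ∑ i, (∏ l, d i l (n l)) • g i with hD
  have hsplit : A ((S ^ n l₀) (F n)) - ∑ q : Σ i, Fin (r i),
      (∏ l, mulAt (d q.1) l₀ (fun n => φ q.1 q.2 ((S ^ n) (g q.1))) l (n l)) • g' q.1 q.2 =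
      (A.comp (S ^ n l₀)) D + ∑ i, (∏ l, d i l (n l)) • E i := by
    simp only [prod_mulAt, hD, hE, Fintype.sum_sigma, ContinuousLinearMap.comp_apply, map_sub,
      map_sum, map_smul, smul_sub, Finset.smul_sum, Finset.sum_sub_distrib, smul_smul]
    abel
  rw [hsplit]
  have hsum : ∀ᵐ x ∂μ, (∑ i, (∏ l, d i l (n l)) • E i : Lp ℂ p μ) x =
      ∑ i, (∏ l, d i l (n l)) * E i x := by
    filter_upwards [Lp.coeFn_finsetSum (Finset.univ : Finset ι) fun i => (∏ l, d i l (n l)) • E i,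
      ae_all_iff.2 fun i => Lp.coeFn_smul (∏ l, d i l (n l)) (E i)] with x h1 h2
    rw [h1, Finset.sum_apply]
    exact Finset.sum_congr rfl fun i _ => by rw [h2 i, Pi.smul_apply, smul_eq_mul]
  filter_upwards [Lp.coeFn_add ((A.comp (S ^ n l₀)) D) (∑ i, (∏ l, d i l (n l)) • E i), hsum,
    (hA2 _ (hn l₀)).ae_norm_le hC.le (by positivity) (happ n hn),
    ae_all_iff.2 fun i => hg' i (n l₀) (hn l₀)] with x h1 h2 h3 h4
  rw [h1, Pi.add_apply, h2]
  have h5 : ∀ i, ‖(∏ l, d i l (n l)) * E i x‖ ≤ ε / 2 / c := fun i => by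
    have h6 : ‖∏ l, d i l (n l)‖ ≤ ∏ l, K i l + 1 := by
      rw [norm_prod]
      exact (Finset.prod_le_prod (fun l _ => norm_nonneg _) fun l _ => hK i l _).trans (by simp)
    have h7 : 0 < ∏ l, K i l + 1 := by linarith [hKp i]
    calc ‖(∏ l, d i l (n l)) * E i x‖
        ≤ (∏ l, K i l + 1) * (ε / (2 * c * (∏ l, K i l + 1))) := by
          rw [norm_mul]
          exact mul_le_mul h6 (h4 i) (norm_nonneg _) h7.le
      _ = ε / 2 / c := by field_simp
  have h8 : ‖∑ i, (∏ l, d i l (n l)) * E i x‖ ≤ ε / 2 := by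
    refine (norm_sum_le_of_le _ fun i _ => h5 i).trans ?_
    rw [Finset.sum_const, nsmul_eq_mul, Finset.card_univ, mul_div_assoc', div_le_iff₀ hc0]
    nlinarith
  have h9 : C * (ε / (2 * C)) = ε / 2 := by field_simp
  rw [h9] at h3
  exact (norm_add_le _ _).trans (by linarith)

/-- Up to the last transformation, an entangled product is expandable. The property `P j` of the
terms after `j` steps may depend on `j`. -/
theorem exists_expandable_entangledProduct {m k : ℕ} (α : Fin (m + 1) → Fin k)
    (A : Fin m → (Lp ℂ p μ →L[ℂ] Lp ℂ p μ)) (S : Fin (m + 1) → (Lp ℂ p μ →L[ℂ] Lp ℂ p μ))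
    (hA1 : ∀ j, TwistedCompact (A j) (S j.castSucc)) {C : ℝ} (hC : 0 < C)
    (hA2 : ∀ (j : Fin m) (n : ℕ), 1 ≤ n → LinftyBoundedBy C ((A j).comp (S j.castSucc ^ n)))
    (f : Lp ℂ p μ) (P : ℕ → (Fin k → ℕ → ℂ) → Lp ℂ p μ → Prop) (h0 : P 0 1 f)
    (hb : ∀ j d g, P j d g → ∀ l, ∃ K : ℝ, ∀ n, ‖d l n‖ ≤ K)
    (hP : ∀ (j : Fin m) d g (φ : StrongDual ℂ (Lp ℂ p μ)) g', P j d g →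
      P (j + 1) (mulAt d (α j.castSucc) fun n => φ ((S j.castSucc ^ n) g)) g') :
    ∃ F, Expandable (P m) F ∧ ∀ n, entangledProduct α A S f n =
      (S (Fin.last m) ^ n (α (Fin.last m))) (F n) := by
  induction m with
  | zero =>
    refine ⟨fun _ => f, fun ε hε => ⟨Unit, inferInstance, fun _ => 1, fun _ => f, fun _ => h0,
      fun n _ => ?_⟩, fun n => rfl⟩
    filter_upwards [Lp.coeFn_zero ℂ p μ] with x hx
    have h1 : f - ∑ _i : Unit, (∏ l, (1 : Fin k → ℕ → ℂ) l (n l)) • f = 0 := by simp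
    rw [h1, hx]
    simpa using hε.le
  | succ m ih =>
    obtain ⟨F, hF, hFn⟩ := ih (fun j => α j.castSucc) (fun j => A j.castSucc)
      (fun j => S j.castSucc) (fun j => hA1 j.castSucc) (fun j => hA2 j.castSucc)
      (fun j => hP j.castSucc)
    refine ⟨_, hF.step (hA1 (Fin.last m)) hC (hA2 (Fin.last m)) (α (Fin.last m).castSucc)
      (hb m) (fun d g φ g' h => hP (Fin.last m) d g φ g' h), fun n => ?_⟩
    have h1 := hFn n
    simp only [entangledProduct] at h1
    simp only [entangledProduct, alternatingProduct, ContinuousLinearMap.comp_apply, h1]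

end Expansion

/-! ### Multiple Cesàro means of entangled products -/

section MultiCesaro

variable {k : ℕ}

theorem multiCesaro_prod {𝕜 : Type*} [RCLike 𝕜] (w : Fin k → ℕ → 𝕜) (N : ℕ) :
    multiCesaro (fun n : Fin k → ℕ => ∏ l, w l (n l)) N = ∏ l, cesaro (w l) N := by
  have h1 : ∀ l, cesaro (w l) N = ((N : 𝕜)⁻¹) * ∑ n ∈ Finset.Icc 1 N, w l n := fun l => by
    rw [cesaro, RCLike.real_smul_eq_coe_mul]
    simp
  simp only [h1, Finset.prod_mul_distrib, Finset.prod_const, Finset.card_univ, Fintype.card_fin]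
  rw [multiCesaro, ← Finset.prod_univ_sum, RCLike.real_smul_eq_coe_mul]
  simp

theorem multiCesaro_sum {V ι : Type*} [AddCommGroup V] [Module ℝ V] [Fintype ι]
    (F : ι → (Fin k → ℕ) → V) (N : ℕ) :
    multiCesaro (fun n => ∑ i, F i n) N = ∑ i, multiCesaro (F i) N := by
  simp only [multiCesaro, ← Finset.smul_sum]
  rw [Finset.sum_comm]

theorem multiCesaro_add {V : Type*} [AddCommGroup V] [Module ℝ V]
    (F G : (Fin k → ℕ) → V) (N : ℕ) :
    multiCesaro (fun n => F n + G n) N = multiCesaro F N + multiCesaro G N := by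
  simp only [multiCesaro, Finset.sum_add_distrib, smul_add]

theorem multiCesaro_sub {V : Type*} [AddCommGroup V] [Module ℝ V]
    (F G : (Fin k → ℕ) → V) (N : ℕ) :
    multiCesaro (fun n => F n - G n) N = multiCesaro F N - multiCesaro G N := by
  simp only [multiCesaro, Finset.sum_sub_distrib, smul_sub]

theorem multiCesaro_mono {F G : (Fin k → ℕ) → ℝ} (h : ∀ n, (∀ l, 1 ≤ n l) → F n ≤ G n) (N : ℕ) :
    multiCesaro F N ≤ multiCesaro G N := by
  simp only [multiCesaro, smul_eq_mul]
  gcongr with n hn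
  exact h n fun l => (Finset.mem_Icc.1 (Fintype.mem_piFinset.1 hn l)).1

theorem multiCesaro_const_le {c : ℝ} (hc : 0 ≤ c) (N : ℕ) :
    multiCesaro (fun _ : Fin k → ℕ => c) N ≤ c := by
  have h1 : multiCesaro (fun _ : Fin k → ℕ => c) N = ((N : ℝ) ^ k / (N : ℝ) ^ k) * c := by
    simp [multiCesaro, Fintype.card_piFinset]
    ring
  rw [h1]
  exact mul_le_of_le_one_left hc (div_self_le_one _)

theorem norm_multiCesaro_le {V : Type*} [NormedAddCommGroup V] [NormedSpace ℝ V]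
    (F : (Fin k → ℕ) → V) (N : ℕ) : ‖multiCesaro F N‖ ≤ multiCesaro (fun n => ‖F n‖) N := by
  rw [multiCesaro, multiCesaro, norm_smul, smul_eq_mul, Real.norm_of_nonneg (by positivity)]
  gcongr
  exact norm_sum_le _ _

theorem tendsto_prod_zero {ι : Type*} [Fintype ι] {u : ι → ℕ → ℝ} (h0 : ∀ i N, 0 ≤ u i N)
    (hb : ∀ i, ∃ B : ℝ, ∀ᶠ N in atTop, u i N ≤ B) {i₀ : ι} (hi : Tendsto (u i₀) atTop (𝓝 0)) :
    Tendsto (fun N => ∏ i, u i N) atTop (𝓝 0) := by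
  classical
  choose B hB using hb
  have h1 : Tendsto (fun N => u i₀ N * ∏ i ∈ Finset.univ.erase i₀, B i) atTop (𝓝 0) := by
    simpa using hi.mul_const (∏ i ∈ Finset.univ.erase i₀, B i)
  refine squeeze_zero' (Eventually.of_forall fun N => Finset.prod_nonneg fun i _ => h0 i N) ?_ h1
  filter_upwards [eventually_all.2 hB] with N hN
  rw [← Finset.mul_prod_erase _ _ (Finset.mem_univ i₀)]
  exact mul_le_mul_of_nonneg_left
    (Finset.prod_le_prod (fun i _ => h0 i N) fun i _ => hN i) (h0 i₀ N)

end MultiCesaro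

section Pointwise

variable {X : Type*} {T : X → X} {k : ℕ}

/-- The one-variable factors of the term `(∏ₗ d l (n l)) • g (T^(n l₀) x)`: the function `g` is
attached to the index `l₀`, and the constant `1` to the others. -/
noncomputable def factor (g : X → ℂ) (l₀ l : Fin k) : X → ℂ :=
  if l = l₀ then g else 1

theorem prod_factor (d : Fin k → ℕ → ℂ) (g : X → ℂ) (l₀ : Fin k) (n : Fin k → ℕ) (x : X) :
    ∏ l, d l (n l) * factor g l₀ l (T^[n l] x) = (∏ l, d l (n l)) * g (T^[n l₀] x) := by
  have h1 : ∀ l, factor g l₀ l (T^[n l] x) = if l = l₀ then g (T^[n l] x) else 1 := fun l => by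
    unfold factor
    split_ifs <;> rfl
  simp only [Finset.prod_mul_distrib, h1, Finset.prod_ite_eq', Finset.mem_univ, if_true]

variable [MeasurableSpace X] {μ : Measure X} {p : ℝ≥0∞} [Fact (1 ≤ p)]

theorem measurable_factor {g : X → ℂ} (hg : Measurable g) (l₀ l : Fin k) :
    Measurable (factor g l₀ l) := by
  unfold factor
  split_ifs
  · exact hg
  · exact measurable_one

/-- Almost everywhere, an expandable family composed with `T^(n l₀)` is uniformly close to a sum
of products of one-variable sequences. -/
theorem Expandable.ae_approx (hT : MeasurePreserving T μ μ)
    {P : (Fin k → ℕ → ℂ) → Lp ℂ p μ → Prop} {F : (Fin k → ℕ) → Lp ℂ p μ} (hF : Expandable P F)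
    (l₀ : Fin k) {ε : ℝ} (hε : 0 < ε) :
    ∃ (ι : Type) (_ : Fintype ι) (d : ι → Fin k → ℕ → ℂ) (g : ι → Lp ℂ p μ),
      (∀ i, P (d i) (g i)) ∧ ∀ᵐ x ∂μ, ∀ n : Fin k → ℕ, (∀ l, 1 ≤ n l) →
        ‖(koopman p hT ^ n l₀) (F n) x -
          ∑ i, ∏ l, d i l (n l) * factor (g i) l₀ l (T^[n l] x)‖ ≤ ε := by
  obtain ⟨ι, _, d, g, hd, happ⟩ := hF ε hε
  refine ⟨ι, inferInstance, d, g, hd, ae_all_iff.2 fun n => ?_⟩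
  by_cases hn : ∀ l, 1 ≤ n l
  swap
  · exact ae_of_all _ fun x h => absurd h hn
  have hsum : ∀ᵐ x ∂μ, (F n - ∑ i, (∏ l, d i l (n l)) • g i : Lp ℂ p μ) x =
      F n x - ∑ i, (∏ l, d i l (n l)) * g i x := by
    filter_upwards [Lp.coeFn_sub (F n) (∑ i, (∏ l, d i l (n l)) • g i),
      Lp.coeFn_finsetSum (Finset.univ : Finset ι) fun i => (∏ l, d i l (n l)) • g i,
      ae_all_iff.2 fun i => Lp.coeFn_smul (∏ l, d i l (n l)) (g i)] with x h0 h1 h2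
    rw [h0, Pi.sub_apply, h1, Finset.sum_apply]
    congr 1
    exact Finset.sum_congr rfl fun i _ => by rw [h2 i, Pi.smul_apply, smul_eq_mul]
  have hqmp := (hT.iterate (n l₀)).quasiMeasurePreserving
  filter_upwards [koopman_pow_coeFn hT (F n) (n l₀), hqmp.ae hsum, hqmp.ae (happ n hn)]
    with x h1 h2 h3 _
  rw [h2] at h3
  rw [h1]
  simpa only [prod_factor] using h3

variable [IsProbabilityMeasure μ]

theorem integrable_factor {g : X → ℂ} (hg : Integrable g μ) (l₀ l : Fin k) :
    Integrable (factor g l₀ l) μ := by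
  unfold factor
  split_ifs
  · exact hg
  · exact integrable_const 1

/-- One Cesàro null coefficient sequence makes the averages of absolute values
converge to zero. -/
theorem Expandable.ae_tendsto_multiCesaro_norm (hT : Ergodic T μ)
    {P : (Fin k → ℕ → ℂ) → Lp ℂ p μ → Prop} {F : (Fin k → ℕ) → Lp ℂ p μ} (hF : Expandable P F)
    (l₀ l₁ : Fin k) (hb : ∀ d g, P d g → ∀ l, ∃ K : ℝ, ∀ n, ‖d l n‖ ≤ K)
    (hnull : ∀ d g, P d g → IsCesaroNull (d l₁)) :
    ∀ᵐ x ∂μ, Tendsto (multiCesaro fun n : Fin k → ℕ =>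
      ‖(koopman p hT.toMeasurePreserving ^ n l₀) (F n) x‖) atTop (𝓝 0) := by
  choose ι hι d g hd happ using fun j : ℕ => hF.ae_approx hT.toMeasurePreserving l₀
    (by positivity : 0 < 1 / ((j : ℝ) + 1))
  have hterm : ∀ j (i : ι j), ∀ᵐ x ∂μ, Tendsto (fun N => ∏ l, cesaro (fun n =>
      ‖d j i l n * factor (g j i) l₀ l (T^[n] x)‖) N) atTop (𝓝 0) := by
    intro j i
    have hm := fun l => measurable_factor (measurable_Lp (g j i)) l₀ l
    have hint := fun l => integrable_factor (integrable_Lp (g j i)) l₀ l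
    filter_upwards [ae_tendsto_cesaro_null_mul hT (hnull _ _ (hd j i)) (hm l₁) (hint l₁),
      ae_all_iff.2 fun l => ae_eventually_cesaro_le hT (hm l).norm (hint l).norm
        (lt_add_one (∫ x, ‖factor (g j i) l₀ l x‖ ∂μ))] with x h1 h2
    refine tendsto_prod_zero (fun l N => cesaro_nonneg (fun n => norm_nonneg _) N) (fun l => ?_)
      (i₀ := l₁) (by simpa only [norm_mul] using h1)
    obtain ⟨K, hK⟩ := hb _ _ (hd j i) l
    have hK0 : 0 ≤ K := (norm_nonneg _).trans (hK 0)
    refine ⟨K * (∫ x, ‖factor (g j i) l₀ l x‖ ∂μ + 1), ?_⟩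
    filter_upwards [h2 l] with N hN
    refine (cesaro_mono (v := fun n => K * ‖factor (g j i) l₀ l (T^[n] x)‖) (fun n _ => ?_) N).trans
      ?_
    · rw [norm_mul]
      gcongr
      exact hK n
    · rw [cesaro_const_mul]
      gcongr
  have hterm' : ∀ᵐ x ∂μ, ∀ j, ∀ i : ι j, Tendsto (fun N => ∏ l, cesaro (fun n =>
      ‖d j i l n * factor (g j i) l₀ l (T^[n] x)‖) N) atTop (𝓝 0) :=
    ae_all_iff.2 fun j => ae_all_iff.2 (hterm j)
  filter_upwards [hterm', ae_all_iff.2 happ] with x h1 h2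
  have hnn : ∀ N, 0 ≤ multiCesaro (fun n : Fin k → ℕ =>
      ‖(koopman p hT.toMeasurePreserving ^ n l₀) (F n) x‖) N := fun N =>
    (norm_nonneg _).trans (norm_multiCesaro_le (V := ℂ) _ N)
  refine tendsto_order.2 ⟨fun a ha => Eventually.of_forall fun N => ha.trans_le (hnn N),
    fun ε hε => ?_⟩
  obtain ⟨j, hj⟩ := exists_nat_one_div_lt (half_pos hε)
  have h3 : Tendsto (fun N => ∑ i : ι j, ∏ l, cesaro (fun n =>
      ‖d j i l n * factor (g j i) l₀ l (T^[n] x)‖) N) atTop (𝓝 0) := by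
    simpa using tendsto_finsetSum Finset.univ fun i _ => h1 j i
  filter_upwards [h3.eventually (gt_mem_nhds (half_pos hε))] with N hN
  have h4 := multiCesaro_mono (G := fun n => 1 / ((j : ℝ) + 1) + ∑ i : ι j, ∏ l,
      ‖d j i l (n l) * factor (g j i) l₀ l (T^[n l] x)‖) (fun n hn => by
    have h5 := norm_le_norm_sub_add ((koopman p hT.toMeasurePreserving ^ n l₀) (F n) x)
      (∑ i, ∏ l, d j i l (n l) * factor (g j i) l₀ l (T^[n l] x))
    refine h5.trans (add_le_add (h2 j n hn) ?_)
    refine (norm_sum_le _ _).trans (le_of_eq ?_)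
    simp only [norm_prod]) N
  rw [multiCesaro_add, multiCesaro_sum] at h4
  have h6 : ∀ i : ι j, multiCesaro (fun n : Fin k → ℕ => ∏ l,
      ‖d j i l (n l) * factor (g j i) l₀ l (T^[n l] x)‖) N = ∏ l, cesaro (fun n =>
      ‖d j i l n * factor (g j i) l₀ l (T^[n] x)‖) N := fun i =>
    multiCesaro_prod (fun l n => ‖d j i l n * factor (g j i) l₀ l (T^[n] x)‖) N
  simp only [h6] at h4
  have h7 := multiCesaro_const_le (k := k) (c := 1 / ((j : ℝ) + 1)) (by positivity) N
  linarith

/-- Besicovitch almost periodic coefficients give convergent averages. -/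
theorem Expandable.ae_exists_tendsto_multiCesaro (hT : Ergodic T μ)
    {P : (Fin k → ℕ → ℂ) → Lp ℂ p μ → Prop} {F : (Fin k → ℕ) → Lp ℂ p μ} (hF : Expandable P F)
    (l₀ : Fin k) (hP : ∀ d g, P d g → ∀ l, IsBesicovitch (d l)) :
    ∀ᵐ x ∂μ, ∃ c : ℂ, Tendsto (multiCesaro fun n : Fin k → ℕ =>
      (koopman p hT.toMeasurePreserving ^ n l₀) (F n) x) atTop (𝓝 c) := by
  choose ι hι d g hd happ using fun j : ℕ => hF.ae_approx hT.toMeasurePreserving l₀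
    (by positivity : 0 < 1 / ((j : ℝ) + 1))
  have hterm : ∀ᵐ x ∂μ, ∀ j, ∀ i : ι j, ∀ l, ∃ c, Tendsto (cesaro fun n =>
      d j i l n * factor (g j i) l₀ l (T^[n] x)) atTop (𝓝 c) :=
    ae_all_iff.2 fun j => ae_all_iff.2 fun i => ae_all_iff.2 fun l =>
      (hP _ _ (hd j i) l).weightedConverges hT (measurable_factor (measurable_Lp (g j i)) l₀ l)
        (integrable_factor (integrable_Lp (g j i)) l₀ l)
  filter_upwards [hterm, ae_all_iff.2 happ] with x h1 h2
  choose c hc using h1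
  refine exists_tendsto_of_forall_approx fun ε hε => ?_
  obtain ⟨j, hj⟩ := exists_nat_one_div_lt hε
  refine ⟨multiCesaro fun n => ∑ i, ∏ l, d j i l (n l) * factor (g j i) l₀ l (T^[n l] x),
    ⟨∑ i, ∏ l, c j i l, ?_⟩, Eventually.of_forall fun N => ?_⟩
  · refine (tendsto_finsetSum Finset.univ fun i _ =>
      tendsto_finsetProd Finset.univ fun l _ => hc j i l).congr fun N => ?_
    rw [multiCesaro_sum]
    exact Finset.sum_congr rfl fun i _ =>
      (multiCesaro_prod (fun l n => d j i l n * factor (g j i) l₀ l (T^[n] x)) N).symm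
  · rw [← multiCesaro_sub]
    refine (norm_multiCesaro_le _ N).trans ((multiCesaro_mono (fun n hn => h2 j n hn) N).trans ?_)
    exact (multiCesaro_const_le (by positivity) N).trans hj.le

end Pointwise

theorem IsCesaroNull.mul_bounded {a b : ℕ → ℂ} (ha : IsCesaroNull a) {K : ℝ}
    (hb : ∀ n, ‖b n‖ ≤ K) : IsCesaroNull (a * b) := by
  obtain ⟨⟨C, hC⟩, ha⟩ := ha
  have hK0 : 0 ≤ K := (norm_nonneg _).trans (hb 0)
  refine ⟨⟨C * K, fun n => ?_⟩, ?_⟩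
  · rw [Pi.mul_apply, norm_mul]
    exact mul_le_mul (hC n) (hb n) (norm_nonneg _) ((norm_nonneg _).trans (hC n))
  · refine squeeze_zero (fun N => by positivity) (fun N => ?_)
      (by simpa only [zero_mul] using ha.mul_const K)
    rw [mul_assoc, Finset.sum_mul]
    gcongr with n
    rw [Pi.mul_apply, norm_mul]
    gcongr
    exact hb n

end Entangled

theorem theorem1 {X : Type*} [MeasurableSpace X] [StandardBorelSpace X]
    (μ : Measure X) [IsProbabilityMeasure μ]
    -- there are `m + 1 ≥ 2` transformations `T 0, …, T m` and `m` operators `A 0, …, A (m - 1)`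
    (m k : ℕ) (hm : 1 ≤ m) (hk : 1 ≤ k) (α : Fin (m + 1) → Fin k)
    (T : Fin (m + 1) → X → X) (hT : ∀ j, Ergodic (T j) μ)
    (p : ℝ≥0∞) [Fact (1 ≤ p)] (hp : p ≠ ∞)
    (A : Fin m → (Lp ℂ p μ →L[ℂ] Lp ℂ p μ))
    (hA1 : ∀ j : Fin m, Entangled.TwistedCompact (A j)
      (Entangled.koopman p (hT j.castSucc).toMeasurePreserving))
    (hA2 : ∃ C : ℝ, 0 < C ∧ ∀ (j : Fin m) (n : ℕ), 1 ≤ n →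
      Entangled.LinftyBoundedBy C
        ((A j).comp (Entangled.koopman p (hT j.castSucc).toMeasurePreserving ^ n))) :
    (∀ f ∈ Entangled.stablePart (Entangled.koopman p (hT 0).toMeasurePreserving),
      ∀ᵐ x ∂μ, Tendsto
        (Entangled.multiCesaro (fun n : Fin k → ℕ =>
          ‖Entangled.entangledProduct α A
            (fun j => Entangled.koopman p (hT j).toMeasurePreserving) f n x‖))
        atTop (𝓝 0)) ∧
    (p = 2 →
      ∀ f ∈ Entangled.reversiblePart (Entangled.koopman p (hT 0).toMeasurePreserving),
        ∀ᵐ x ∂μ, ∃ c : ℂ, Tendsto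
          (Entangled.multiCesaro (fun n : Fin k → ℕ =>
            Entangled.entangledProduct α A
              (fun j => Entangled.koopman p (hT j).toMeasurePreserving) f n x))
          atTop (𝓝 c)) := by
  obtain ⟨C, hC, hA2⟩ := hA2
  have hcorr : ∀ (j : Fin (m + 1)) (g : Lp ℂ p μ) (φ : StrongDual ℂ (Lp ℂ p μ)) (n : ℕ),
      ‖φ ((Entangled.koopman p (hT j).toMeasurePreserving ^ n) g)‖ ≤ ‖φ‖ * ‖g‖ :=
    fun j g φ n => (φ.le_opNorm _).trans (mul_le_mul_of_nonneg_left
      (Entangled.norm_pow_apply_le (fun f => (Entangled.norm_koopman _ f).le) n g) (norm_nonneg φ))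
  refine ⟨fun f hf => ?_, ?_⟩
  -- The first step produces a null sequence at the index `α 0`; later steps multiply the
  -- coefficient sequences by bounded ones.
  · obtain ⟨F, hF, hFn⟩ := Entangled.exists_expandable_entangledProduct α A
      (fun j => Entangled.koopman p (hT j).toMeasurePreserving) hA1 hC hA2 f
      (fun j d g => (∀ l, ∃ K : ℝ, ∀ n, ‖d l n‖ ≤ K) ∧
        (if j = 0 then g = f else Entangled.IsCesaroNull (d (α 0))))
      ⟨fun l => ⟨1, fun n => by simp⟩, by simp⟩ (fun j d g h => h.1)
      (fun j d g φ g' h => by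
        have hb : ∀ l, ∃ K : ℝ, ∀ n, ‖Entangled.mulAt d (α j.castSucc) (fun n =>
            φ ((Entangled.koopman p (hT j.castSucc).toMeasurePreserving ^ n) g)) l n‖ ≤ K := by
          intro l
          obtain ⟨K, hK⟩ := h.1 l
          have hK0 : 0 ≤ K := (norm_nonneg _).trans (hK 0)
          rcases eq_or_ne l (α j.castSucc) with rfl | hl
          · rw [Entangled.mulAt_self]
            refine ⟨K * (‖φ‖ * ‖g‖), fun n => ?_⟩
            rw [Pi.mul_apply, norm_mul]
            exact mul_le_mul (hK n) (hcorr _ g φ n) (norm_nonneg _) hK0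
          · rw [Entangled.mulAt_of_ne d _ hl]
            exact ⟨K, hK⟩
        refine ⟨hb, ?_⟩
        rw [if_neg (Nat.succ_ne_zero _)]
        obtain ⟨h1, h2⟩ := h
        by_cases hj : (j : ℕ) = 0
        · rw [if_pos hj] at h2
          have hj0 : j.castSucc = 0 := Fin.ext hj
          obtain ⟨K, hK⟩ := h1 (α 0)
          rw [h2, hj0, Entangled.mulAt_self, mul_comm]
          exact (hf φ).mul_bounded hK
        · rw [if_neg hj] at h2
          rcases eq_or_ne (α 0) (α j.castSucc) with hl | hl
          · rw [hl, Entangled.mulAt_self, ← hl]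
            exact h2.mul_bounded (hcorr _ g φ)
          · rwa [Entangled.mulAt_of_ne d _ hl])
    simp only [hFn]
    exact hF.ae_tendsto_multiCesaro_norm (hT (Fin.last m)) _ (α 0) (fun d g h => h.1)
      fun d g h => by simpa only [if_neg (Nat.one_le_iff_ne_zero.1 hm)] using h.2
  · rintro rfl f -
    -- On `L²` all correlation sequences are Besicovitch almost periodic, also those of the
    -- vectors `g` that the expansions produce.
    obtain ⟨F, hF, hFn⟩ := Entangled.exists_expandable_entangledProduct α A
      (fun j => Entangled.koopman 2 (hT j).toMeasurePreserving) hA1 hC hA2 f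
      (fun _ d _ => ∀ l, Entangled.IsBesicovitch (d l))
      (fun l => Entangled.isBesicovitch_one) (fun j d g h l => (h l).1)
      (fun j d g φ g' h l => by
        rcases eq_or_ne l (α j.castSucc) with rfl | hl
        · rw [Entangled.mulAt_self]
          exact (h _).mul (Entangled.isBesicovitch_koopman _ g φ)
        · rw [Entangled.mulAt_of_ne d _ hl]
          exact h l)
    simp only [hFn]
    exact hF.ae_exists_tendsto_multiCesaro (hT (Fin.last m)) _ fun d g h => h
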